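/- Let $M$ be a smooth manifold of dimension $m\ge 2$, let $\Omega$ be a volume form on $M$ (a smooth nowhere vanishing $m$-form; in particular $M$ is orientable), and let $X$ be a smooth vector field on $M$. Suppose that $$\iota_X\Omega = d\varrho$$ for some smooth $(m-2)$-form $\varrho$ of rank at most two at every point. Here the rank of $\varrho$ at $x$ is the rank of the skew-symmetric matrix $[\varrho_{ij}(x)]$, where in local coordinates $$\varrho=\sum_{i<j}\varrho_{ij}\,dx^1\wedge\cdots\wedge\widehat{dx^i}\wedge\cdots\wedge\widehat{dx^j}\wedge\cdots\wedge dx^m .$$ Suppose moreover that $\varrho$ admits an integrating factor $a\in C^\infty(M)$, that is, $d(a\varrho)=0$, and put $U:=\{x\in M : a(x)\neq 0\}$. Then there is a unique bivector field $\pi$ on $M$ with $$\iota_\pi\Omega = a\varrho ,$$ where $\iota_{A\wedge B}=\iota_A\circ\iota_B$, and it has the following properties. 1. $\pi$ is a smooth Poisson structure on $M$, that is, its Schouten–Nijenhuis bracket $[\pi,\pi]$ vanishes, and it has rank at most two, that is, $\dim\pi^\sharp(T_x^*M)\le 2$ for every $x\in M$, where $\pi^\sharp\alpha=\iota_\alpha\pi=\pi(\alpha,\cdot)$.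 2. $\pi$ is unimodular on $M$, and its restriction to $U$ is unimodular on $U$: there is a volume form on $M$ (respectively on $U$) that is invariant under the flows of all Hamiltonian vector fields $\pi^\sharp dh$ with $h\in C^\infty(M)$ (respectively $h\in C^\infty(U)$). 3. On the open set $U$, the vector field $X$ is Hamiltonian for $\pi$, with Hamiltonian function $1/a$, that is, $X=\pi^\sharp d(1/a)$ on $U$. -/

import Mathlib

open Set Manifold
open scoped ContDiff

noncomputable section

namespace Hamiltonization

/-! ### Pointwise multilinear algebra -/

section Pointwise

variable {V : Type*} [AddCommGroup V] [Module ℝ V] [TopologicalSpace V]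

/-- The interior product `ι_A η = η(A, ·, …, ·)` of a vector with an alternating form. -/
def interiorVec {n : ℕ} (A : V) (η : V [⋀^Fin (n + 1)]→L[ℝ] ℝ) : V [⋀^Fin n]→L[ℝ] ℝ :=
  { η.toAlternatingMap.curryLeft A with
    cont := η.cont.comp (continuous_const.matrixVecCons continuous_id) }

@[simp]
theorem interiorVec_apply {n : ℕ} (A : V) (η : V [⋀^Fin (n + 1)]→L[ℝ] ℝ) (v : Fin n → V) :
    interiorVec A η v = η (Matrix.vecCons A v) := rfl

end Pointwise

variable {m : ℕ} {M : Type*} [TopologicalSpace M] [ChartedSpace (EuclideanSpace ℝ (Fin m)) M]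

/-! ### Tensor fields on an `m`-dimensional manifold -/

variable (m M) in
/-- (Not necessarily smooth) differential `n`-forms on `M`. -/
abbrev DiffForm (n : ℕ) : Type _ :=
  (x : M) → TangentSpace (𝓡 m) x [⋀^Fin n]→L[ℝ] ℝ

variable (m M) in
/-- (Not necessarily smooth) bivector fields on `M`. An element of `⋀² T_x M` is regarded as an
alternating bilinear form on the cotangent space, `A ∧ B` being
`(α, β) ↦ α(A) β(B) - α(B) β(A)`. -/
abbrev BivectorField : Type _ :=
  (x : M) → (TangentSpace (𝓡 m) x →L[ℝ] ℝ) [⋀^Fin 2]→L[ℝ] ℝ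

/-- The coordinate vector `∂/∂x^i` at `x`, for the coordinates given by the preferred chart at `x`:
Mathlib identifies `T_x M` with `ℝ^m` through the differential at `x` of that chart. -/
def coordVec (x : M) (i : Fin m) : TangentSpace (𝓡 m) x :=
  (EuclideanSpace.single i 1 : EuclideanSpace ℝ (Fin m))

/-- The coordinate differential `dx^i` at `x`, for the coordinates given by the preferred chart
at `x`. -/
def coordCovec (x : M) (i : Fin m) : TangentSpace (𝓡 m) x →L[ℝ] ℝ :=
  (EuclideanSpace.proj i : EuclideanSpace ℝ (Fin m) →L[ℝ] ℝ)

/-- The differential at `p` of the chart `φ` around `x₀`. -/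
def dChart (x₀ p : M) : TangentSpace (𝓡 m) p →L[ℝ] EuclideanSpace ℝ (Fin m) :=
  mvfderiv (𝓡 m) (extChartAt (𝓡 m) x₀) p

/-- The differential at `y` of the inverse of the chart `φ` around `x₀`. -/
def dChartSymm (x₀ : M) (y : EuclideanSpace ℝ (Fin m)) :
    EuclideanSpace ℝ (Fin m) →L[ℝ] TangentSpace (𝓡 m) ((extChartAt (𝓡 m) x₀).symm y) :=
  mfderiv 𝓘(ℝ, EuclideanSpace ℝ (Fin m)) (𝓡 m) (extChartAt (𝓡 m) x₀).symm y

/-- The local representation `(φ⁻¹)^* η` of a form in the chart `φ` around `x₀`; it is meaningful on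
the target of `φ`. -/
def formInChart {n : ℕ} (η : DiffForm m M n) (x₀ : M) (y : EuclideanSpace ℝ (Fin m)) :
    EuclideanSpace ℝ (Fin m) [⋀^Fin n]→L[ℝ] ℝ :=
  (η ((extChartAt (𝓡 m) x₀).symm y)).compContinuousLinearMap (dChartSymm x₀ y)

/-- The local representation `φ_* π`, `(φ_* π)_y(α, β) = π(φ^* α, φ^* β)`, of a bivector field in the
chart `φ` around `x₀`; it is meaningful on the target of `φ`. -/
def bivectorInChart (π : BivectorField m M) (x₀ : M) (y : EuclideanSpace ℝ (Fin m)) :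
    (EuclideanSpace ℝ (Fin m) →L[ℝ] ℝ) [⋀^Fin 2]→L[ℝ] ℝ :=
  (π ((extChartAt (𝓡 m) x₀).symm y)).compContinuousLinearMap
    (ContinuousLinearMap.precomp ℝ (dChart x₀ ((extChartAt (𝓡 m) x₀).symm y)))

/-- Smoothness of a differential form on an open set `V`: its coefficients are smooth in the preferred
charts, which cover `M`. -/
def SmoothFormOn {n : ℕ} (η : DiffForm m M n) (V : Set M) : Prop :=
  ∀ x₀ : M, ContDiffOn ℝ ∞ (formInChart η x₀)
    ((extChartAt (𝓡 m) x₀).target ∩ (extChartAt (𝓡 m) x₀).symm ⁻¹' V)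

/-- Smoothness of a bivector field on an open set `V`: its coefficients are smooth in the
preferred charts, which cover `M`. -/
def SmoothBivectorOn (π : BivectorField m M) (V : Set M) : Prop :=
  ∀ x₀ : M, ContDiffOn ℝ ∞ (bivectorInChart π x₀)
    ((extChartAt (𝓡 m) x₀).target ∩ (extChartAt (𝓡 m) x₀).symm ⁻¹' V)

/-- The exterior derivative of a form on a manifold, computed at `x` in the chart at `x`. -/
def extDer {n : ℕ} (η : DiffForm m M n) : DiffForm m M (n + 1) := fun x =>
  (extDeriv (formInChart η x) (extChartAt (𝓡 m) x x)).compContinuousLinearMap (dChart x x)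

/-- A volume form on the open set `V`: a smooth nowhere vanishing form of top degree. -/
def IsVolumeFormOn (Ω : DiffForm m M m) (V : Set M) : Prop :=
  SmoothFormOn Ω V ∧ ∀ x ∈ V, Ω x ≠ 0

/-! ### Poisson structures -/

/-- The contraction `π^♯ : T_x^* M → T_x M`, `π^♯ α = π(α, ·)`, that is
`(A ∧ B)^♯ α = α(A) B - α(B) A`. -/
def sharp (π : BivectorField m M) (x : M) :
    (TangentSpace (𝓡 m) x →L[ℝ] ℝ) →ₗ[ℝ] TangentSpace (𝓡 m) x where
  toFun α := ∑ i : Fin m, π x ![α, coordCovec x i] • coordVec x i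
  map_add' α β := by
    rw [← Finset.sum_add_distrib]
    refine Finset.sum_congr rfl fun i _ => ?_
    rw [← add_smul]
    congr 1
    exact (π x).toMultilinearMap.cons_add ![coordCovec x i] α β
  map_smul' c α := by
    rw [Finset.smul_sum]
    refine Finset.sum_congr rfl fun i _ => ?_
    rw [smul_smul]
    congr 1
    exact (π x).toMultilinearMap.cons_smul ![coordCovec x i] c α

/-- The rank of a bivector field at `x`: the dimension of `π^♯(T_x^* M)`. -/
def bivectorRank (π : BivectorField m M) (x : M) : ℕ :=
  Module.finrank ℝ (LinearMap.range (sharp π x))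

/-- The term `∑_l π^{al} ∂_l ψ^{bc}` of the coordinate formula for the Schouten bracket, contracted
with covectors `α, β, γ` at `x`: the derivative along `π^♯ α` of the coefficient
`ψ(β, γ)`, the covectors `β`, `γ` being extended with constant coefficients in the chart at `x`. -/
def schoutenTerm (π ψ : BivectorField m M) (x : M) (α β γ : TangentSpace (𝓡 m) x →L[ℝ] ℝ) : ℝ :=
  fderiv ℝ (bivectorInChart ψ x) (extChartAt (𝓡 m) x x) (dChart x x (sharp π x α))
    ![(β : EuclideanSpace ℝ (Fin m) →L[ℝ] ℝ), (γ : EuclideanSpace ℝ (Fin m) →L[ℝ] ℝ)]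

/-- The Schouten–Nijenhuis bracket of two bivector fields, the trivector field with components
`[π, ψ]^{abc} = ∑_l (π^{al} ∂_l ψ^{bc} + ψ^{al} ∂_l π^{bc}) + cyclic permutations of a, b, c`,
given through its values on triples of covectors. -/
def schouten (π ψ : BivectorField m M) (x : M) (α β γ : TangentSpace (𝓡 m) x →L[ℝ] ℝ) : ℝ :=
  (schoutenTerm π ψ x α β γ + schoutenTerm π ψ x β γ α + schoutenTerm π ψ x γ α β) +
  (schoutenTerm ψ π x α β γ + schoutenTerm ψ π x β γ α + schoutenTerm ψ π x γ α β)

/-- A Poisson structure on the open set `V`: a smooth bivector field with `[π, π] = 0`. -/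
def IsPoissonOn (π : BivectorField m M) (V : Set M) : Prop :=
  SmoothBivectorOn π V ∧ ∀ x ∈ V, ∀ α β γ, schouten π π x α β γ = 0

/-- The vector field `π^♯ dh`. -/
def hamVec (π : BivectorField m M) (h : M → ℝ) (x : M) : TangentSpace (𝓡 m) x :=
  sharp π x (mvfderiv (𝓡 m) h x)

/-- On the open set `V`, the vector field `X` is Hamiltonian for `π`, with the smooth Hamiltonian
function `h`. -/
def IsHamiltonianOn (π : BivectorField m M) (X : (x : M) → TangentSpace (𝓡 m) x) (h : M → ℝ)
    (V : Set M) : Prop :=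
  ContMDiffOn (𝓡 m) 𝓘(ℝ, ℝ) ∞ h V ∧ ∀ x ∈ V, X x = hamVec π h x

/-- `Φ : D → V`, `(t, x) ↦ Φ_t(x)`, is a (local) flow in the open set `V` of the vector field `Y`:
it is smooth, its domain `D` is open in `ℝ × V`, with `(t, x)` the domain contains the whole segment
from `(0, x)` to `(t, x)`, and the curves `t ↦ Φ_t(x)` are integral curves of `Y` starting at `x`. -/
structure IsFlowOn (Y : (x : M) → TangentSpace (𝓡 m) x) (V : Set M) (D : Set (ℝ × M))
    (Φ : ℝ × M → M) : Prop where
  isOpen : IsOpen D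
  subset : ∀ p ∈ D, p.2 ∈ V
  segment : ∀ p ∈ D, ∀ s ∈ uIcc 0 p.1, (s, p.2) ∈ D
  mapsTo : MapsTo Φ D V
  smooth : ContMDiffOn (𝓘(ℝ, ℝ).prod (𝓡 m)) (𝓡 m) ∞ Φ D
  initial : ∀ p ∈ D, Φ (0, p.2) = p.2
  integral : ∀ x : M, IsMIntegralCurveOn (fun t => Φ (t, x)) Y {t | (t, x) ∈ D}

/-- The pull-back form `f^* η`. -/
def pullbackForm {n : ℕ} (f : M → M) (η : DiffForm m M n) : DiffForm m M n := fun x =>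
  (η (f x)).compContinuousLinearMap (mfderiv (𝓡 m) (𝓡 m) f x)

/-- On the open set `V`, the form `μ` is invariant under all flows of the vector field `Y`. -/
def FlowInvariantOn {n : ℕ} (μ : DiffForm m M n) (Y : (x : M) → TangentSpace (𝓡 m) x)
    (V : Set M) : Prop :=
  ∀ (D : Set (ℝ × M)) (Φ : ℝ × M → M), IsFlowOn Y V D Φ →
    ∀ p ∈ D, pullbackForm (fun x => Φ (p.1, x)) μ p.2 = μ p.2

/-- A unimodular Poisson structure on the open set `V`: there is a volume form on `V` that is
invariant under the flows of all Hamiltonian vector fields on `V`. -/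
def IsUnimodularPoissonOn (π : BivectorField m M) (V : Set M) : Prop :=
  IsPoissonOn π V ∧ ∃ μ : DiffForm m M m, IsVolumeFormOn μ V ∧
    ∀ h : M → ℝ, ContMDiffOn (𝓡 m) 𝓘(ℝ, ℝ) ∞ h V → FlowInvariantOn μ (hamVec π h) V

end Hamiltonization

namespace Hamiltonization

variable {k : ℕ} {M : Type*} [TopologicalSpace M]
  [ChartedSpace (EuclideanSpace ℝ (Fin (k + 2))) M]

/-! ### Forms of codegree two -/

/-- The interior product `ι_π Ω = ∑_{i<j} π^{ij} ι_{∂_i} ι_{∂_j} Ω` of a bivector field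
`π = ∑_{i<j} π^{ij} ∂_i ∧ ∂_j` with a form, according to the rule `ι_{A ∧ B} = ι_A ∘ ι_B`. -/
def interiorBivector (π : BivectorField (k + 2) M) (Ω : DiffForm (k + 2) M (k + 2)) :
    DiffForm (k + 2) M k := fun x =>
  ∑ i, ∑ j ∈ Finset.Ioi i, π x ![coordCovec x i, coordCovec x j] •
    interiorVec (coordVec x i) (interiorVec (coordVec x j) (Ω x))

/-- For `i < j`, the increasing enumeration of all indices other than `i` and `j`. -/
def omitTwo (i j : Fin (k + 2)) (h : i < j) (l : Fin k) : Fin (k + 2) :=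
  j.succAbove ((i.castLT (by omega) : Fin (k + 1)).succAbove l)

/-- The skew-symmetric matrix `[ϱ_{ij}]` of the coefficients at `x` of
`ϱ = ∑_{i<j} ϱ_{ij} dx^1 ∧ ⋯ (omit dx^i) ⋯ (omit dx^j) ⋯ ∧ dx^m`, where `m = k + 2`. -/
def coeffMatrix (ϱ : DiffForm (k + 2) M k) (x : M) : Matrix (Fin (k + 2)) (Fin (k + 2)) ℝ :=
  Matrix.of fun i j =>
    if h : i < j then ϱ x (fun l => coordVec x (omitTwo i j h l))
    else if h : j < i then -ϱ x (fun l => coordVec x (omitTwo j i h l))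
    else 0

/-- The rank at `x` of a form of codegree two. -/
def formRank (ϱ : DiffForm (k + 2) M k) (x : M) : ℕ := (coeffMatrix ϱ x).rank

end Hamiltonization

end

noncomputable section

namespace Hamiltonization

/-! ### Multilinear algebra on the coordinate space -/

/-! Contraction with a nonzero top-degree form is a linear isomorphism from bivectors to forms of
codegree two, since it matches coefficients up to sign and one nonzero factor
(`interiorBivec_apply_omitTwo`). This gives existence and uniqueness of `π`. It also shows that the
matrix of `π` has rank at most that of `ϱ` (`rank_bivecMatrix_le`), hence at most two.

Everything else rests on the pointwise identity `α ∧ ι_P Ω = ι_{P^♯ α} Ω`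
(`covecWedge_interiorBivec`). In a chart write `Ω = ρ vol` with `vol` constant, so that `aϱ = ι_{ρπ}
vol`. The identity turns `d(aϱ)` into the contraction of `vol` with the divergence of `ρπ`, and
closedness of `aϱ` becomes `div(ρπ) = 0` (`bivecDiv_inChart_eq_zero`). Two consequences follow.

Jacobi identity: rank at most two gives the Plücker relations `π(α,δ)π(β,γ) + cyclic = 0` in `α, β,
γ`. Put `δ = dx^l`, multiply by `ρ`, apply `∂_l` and sum over `l`. The terms where `ρπ(·, dx^l)` is
differentiated are divergences and vanish; the remaining ones are `ρ` times half the Schouten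
bracket (`sum_cyclic_eq_zero_of_bivecDiv_eq_zero`).

Unimodularity: `π^♯ dh` has zero divergence with respect to `ρ`, because the Hessian of `h` is
symmetric and `π` is skew (`divergence_hamiltonian`). The pull-back of `Ω` along a flow then has
zero time derivative (`hasDerivAt_pullback_density`), so `Ω` itself is the invariant volume form, on
`M` and on `{a ≠ 0}`.

Hamiltonian: multiplying `0 = d(aϱ) = da ∧ ϱ + a dϱ` by `a` and using the identity gives `π^♯ da =
-a² X`, that is `X = π^♯ d(1/a)` where `a ≠ 0`. -/

/-- The coordinate space `ℝ^n`. -/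
abbrev Coord (n : ℕ) : Type := EuclideanSpace ℝ (Fin n)

/-- Covectors on the coordinate space. -/
abbrev Covec (n : ℕ) : Type := Coord n →L[ℝ] ℝ

/-- Bivectors on the coordinate space. -/
abbrev Bivec (n : ℕ) : Type := Covec n [⋀^Fin 2]→L[ℝ] ℝ

/-- The standard basis vectors. -/
def stdVec {n : ℕ} (i : Fin n) : Coord n := EuclideanSpace.single i 1

/-- The standard basis covectors. -/
def stdCovec {n : ℕ} (i : Fin n) : Covec n := EuclideanSpace.proj i

theorem stdCovec_apply {n : ℕ} (i : Fin n) (v : Coord n) : stdCovec i v = v i := rfl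

theorem stdCovec_stdVec {n : ℕ} (i j : Fin n) :
    stdCovec i (stdVec j) = if i = j then 1 else 0 := by
  simp [stdCovec, stdVec]

theorem sum_stdCovec_smul_stdVec {n : ℕ} (v : Coord n) : ∑ i, stdCovec i v • stdVec i = v := by
  ext j
  simp [stdCovec, stdVec, Pi.single_apply]

theorem covec_eq_sum {n : ℕ} (α : Covec n) : α = ∑ i, α (stdVec i) • stdCovec i := by
  ext v
  conv_lhs => rw [← sum_stdCovec_smul_stdVec v]
  simp [mul_comm]

theorem coord_ext {n : ℕ} {v w : Coord n} (h : ∀ β : Covec n, β v = β w) : v = w := by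
  ext i
  exact h (stdCovec i)

theorem stdVec_eq_basis {n : ℕ} :
    (stdVec : Fin n → Coord n) = (EuclideanSpace.basisFun (Fin n) ℝ).toBasis := by
  ext i
  simp [stdVec]

theorem bivec_swap {n : ℕ} (P : Bivec n) (α β : Covec n) : P ![β, α] = -P ![α, β] := by
  have := P.toAlternatingMap.map_swap ![α, β] (i := 0) (j := 1) (by decide)
  rw [← P.coe_toAlternatingMap, ← this]
  congr 1
  ext i
  fin_cases i <;> simp

/-- The bilinear form underlying a bivector. -/
def bivecBilin {n : ℕ} (P : Bivec n) : Covec n →ₗ[ℝ] Covec n →ₗ[ℝ] ℝ :=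
  LinearMap.mk₂ ℝ (fun α β => P ![α, β])
    (fun α α' β => P.toMultilinearMap.cons_add ![β] α α')
    (fun c α β => P.toMultilinearMap.cons_smul ![β] c α)
    (fun α β β' => by
      rw [bivec_swap, bivec_swap P β, bivec_swap P β', ← neg_add]
      exact congrArg Neg.neg (P.toMultilinearMap.cons_add ![α] β β'))
    (fun c α β => by
      rw [bivec_swap, bivec_swap P β, smul_neg]
      exact congrArg Neg.neg (P.toMultilinearMap.cons_smul ![α] c β))

theorem bivecBilin_apply {n : ℕ} (P : Bivec n) (α β : Covec n) :
    bivecBilin P α β = P ![α, β] := rfl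

theorem bivec_self {n : ℕ} (P : Bivec n) (α : Covec n) : P ![α, α] = 0 :=
  P.map_eq_zero_of_eq ![α, α] (i := 0) (j := 1) rfl (by decide)

theorem bivec_eq_sum {n : ℕ} (P : Bivec n) (α β : Covec n) :
    P ![α, β] = ∑ i, ∑ j, α (stdVec i) * β (stdVec j) * P ![stdCovec i, stdCovec j] := by
  simp only [← bivecBilin_apply]
  conv_lhs => rw [covec_eq_sum α, covec_eq_sum β]
  simp only [map_sum, LinearMap.sum_apply, map_smul, LinearMap.smul_apply, smul_eq_mul,
    Finset.mul_sum]
  rw [Finset.sum_comm]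
  exact Finset.sum_congr rfl fun i _ => Finset.sum_congr rfl fun j _ => by ring

theorem bivec_ext {n : ℕ} {P Q : Bivec n} (h : ∀ α β, P ![α, β] = Q ![α, β]) : P = Q := by
  ext v
  have : v = ![v 0, v 1] := by ext i; fin_cases i <;> rfl
  rw [this]
  exact h _ _

theorem bivec_ext_stdCovec {n : ℕ} {P Q : Bivec n}
    (h : ∀ i j, i < j → P ![stdCovec i, stdCovec j] = Q ![stdCovec i, stdCovec j]) : P = Q := by
  refine bivec_ext fun α β => ?_
  rw [bivec_eq_sum P, bivec_eq_sum Q]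
  refine Finset.sum_congr rfl fun i _ => Finset.sum_congr rfl fun j _ => ?_
  congr 1
  rcases lt_trichotomy i j with hij | rfl | hij
  · exact h i j hij
  · rw [bivec_self, bivec_self]
  · rw [bivec_swap, bivec_swap Q, h j i hij]

/-- The bivector `A ∧ B`. -/
def wedgeVec {n : ℕ} (A B : Coord n) : Bivec n :=
  ContinuousAlternatingMap.alternatizeUncurryFin
    ((ContinuousLinearMap.apply ℝ ℝ A).smulRight
      (ContinuousAlternatingMap.ofSubsingleton ℝ (Covec n) ℝ (0 : Fin 1)
        (ContinuousLinearMap.apply ℝ ℝ B)))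

theorem wedgeVec_apply {n : ℕ} (A B : Coord n) (α β : Covec n) :
    wedgeVec A B ![α, β] = α A * β B - β A * α B := by
  simp [wedgeVec, ContinuousAlternatingMap.alternatizeUncurryFin_apply, Fin.sum_univ_two,
    Fin.removeNth, sub_eq_add_neg]

/-- The contraction `P^♯ α = P(α, ·)`. -/
def bivecSharp {n : ℕ} (P : Bivec n) (α : Covec n) : Coord n :=
  ∑ i, P ![α, stdCovec i] • stdVec i

theorem apply_bivecSharp {n : ℕ} (P : Bivec n) (α β : Covec n) :
    β (bivecSharp P α) = P ![α, β] := by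
  rw [bivecSharp, map_sum]
  simp only [← bivecBilin_apply]
  conv_rhs => rw [covec_eq_sum β]
  simp [mul_comm]

/-- The interior product `ι_P Ω` of a bivector with a form. -/
def interiorBivec {n k : ℕ} (P : Bivec n) (Ω : Coord n [⋀^Fin (k + 2)]→L[ℝ] ℝ) :
    Coord n [⋀^Fin k]→L[ℝ] ℝ :=
  ∑ i, ∑ j ∈ Finset.Ioi i, P ![stdCovec i, stdCovec j] •
    interiorVec (stdVec i) (interiorVec (stdVec j) Ω)

theorem interiorBivec_smul_left {n k : ℕ} (c : ℝ) (P : Bivec n)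
    (Ω : Coord n [⋀^Fin (k + 2)]→L[ℝ] ℝ) :
    interiorBivec (c • P) Ω = c • interiorBivec P Ω := by
  simp [interiorBivec, Finset.smul_sum, smul_smul]

theorem interiorBivec_add_left {n k : ℕ} (P Q : Bivec n)
    (Ω : Coord n [⋀^Fin (k + 2)]→L[ℝ] ℝ) :
    interiorBivec (P + Q) Ω = interiorBivec P Ω + interiorBivec Q Ω := by
  simp [interiorBivec, Finset.sum_add_distrib, add_smul]

theorem interiorVec_add_left {n k : ℕ} (A B : Coord n)
    (Ω : Coord n [⋀^Fin (k + 1)]→L[ℝ] ℝ) :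
    interiorVec (A + B) Ω = interiorVec A Ω + interiorVec B Ω := by
  ext w
  exact Ω.toMultilinearMap.cons_add w A B

theorem interiorVec_smul_left {n k : ℕ} (c : ℝ) (A : Coord n)
    (Ω : Coord n [⋀^Fin (k + 1)]→L[ℝ] ℝ) :
    interiorVec (c • A) Ω = c • interiorVec A Ω := by
  ext w
  exact Ω.toMultilinearMap.cons_smul w c A

theorem interiorVec_sum_left {n k : ℕ} {ι : Type*} (s : Finset ι) (A : ι → Coord n)
    (Ω : Coord n [⋀^Fin (k + 1)]→L[ℝ] ℝ) :
    interiorVec (∑ i ∈ s, A i) Ω = ∑ i ∈ s, interiorVec (A i) Ω := by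
  have h0 : interiorVec (0 : Coord n) Ω = 0 := by
    simpa using interiorVec_smul_left (0 : ℝ) (0 : Coord n) Ω
  classical
  induction s using Finset.induction_on with
  | empty => simpa using h0
  | insert a s ha ih => rw [Finset.sum_insert ha, Finset.sum_insert ha, interiorVec_add_left, ih]

theorem interiorVec_smul_right {n k : ℕ} (c : ℝ) (A : Coord n)
    (Ω : Coord n [⋀^Fin (k + 1)]→L[ℝ] ℝ) :
    interiorVec A (c • Ω) = c • interiorVec A Ω := by
  ext w
  simp

theorem interiorBivec_smul_right {n k : ℕ} (c : ℝ) (P : Bivec n)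
    (Ω : Coord n [⋀^Fin (k + 2)]→L[ℝ] ℝ) :
    interiorBivec P (c • Ω) = c • interiorBivec P Ω := by
  simp only [interiorBivec, interiorVec_smul_right, Finset.smul_sum]
  refine Finset.sum_congr rfl fun i _ => Finset.sum_congr rfl fun j _ => ?_
  rw [smul_comm]

theorem interiorVec_swap {n k : ℕ} (A B : Coord n) (Ω : Coord n [⋀^Fin (k + 2)]→L[ℝ] ℝ) :
    interiorVec A (interiorVec B Ω) = -interiorVec B (interiorVec A Ω) := by
  ext w
  have := Ω.toAlternatingMap.map_swap (Matrix.vecCons A (Matrix.vecCons B w)) (i := 0) (j := 1)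
    (by simp)
  rw [ContinuousAlternatingMap.neg_apply, interiorVec_apply, interiorVec_apply, interiorVec_apply,
    interiorVec_apply, ← Ω.coe_toAlternatingMap, ← this]
  congr 1
  ext i : 1
  refine Fin.cases ?_ (fun i => Fin.cases ?_ (fun i => ?_) i) i
  · simp
  · simp
  · have h0 : i.succ.succ ≠ (0 : Fin (k + 2)) := by simp
    have h1 : i.succ.succ ≠ (1 : Fin (k + 2)) := by simp [Fin.ext_iff]
    simp [Equiv.swap_apply_of_ne_of_ne h0 h1]

/-- The interior product with a bivector as a sum over all pairs of indices. -/
theorem two_smul_interiorBivec {n k : ℕ} (P : Bivec n) (Ω : Coord n [⋀^Fin (k + 2)]→L[ℝ] ℝ) :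
    (2 : ℝ) • interiorBivec P Ω = ∑ i, ∑ j, P ![stdCovec i, stdCovec j] •
      interiorVec (stdVec i) (interiorVec (stdVec j) Ω) := by
  set f : Fin n → Fin n → Coord n [⋀^Fin k]→L[ℝ] ℝ := fun i j =>
    P ![stdCovec i, stdCovec j] • interiorVec (stdVec i) (interiorVec (stdVec j) Ω) with hf
  have hsymm : ∀ i j, f i j = f j i := fun i j => by
    simp only [hf]
    rw [bivec_swap, interiorVec_swap, smul_neg, neg_smul, neg_neg]
  have hdiag : ∀ i, f i i = 0 := fun i => by simp only [hf]; rw [bivec_self, zero_smul]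
  have hsplit : ∀ i, ∑ j, f i j = ∑ j ∈ Finset.Ioi i, f i j + ∑ j ∈ Finset.Iio i, f i j := by
    intro i
    rw [← Finset.sum_union]
    · symm
      refine Finset.sum_subset (Finset.subset_univ _) fun j _ hj => ?_
      have : j = i := by
        simp only [Finset.mem_union, Finset.mem_Ioi, Finset.mem_Iio, not_or, not_lt] at hj
        exact le_antisymm hj.1 hj.2
      rw [this, hdiag]
    · rw [Finset.disjoint_left]
      intro j h1 h2
      exact lt_asymm (Finset.mem_Ioi.1 h1) (Finset.mem_Iio.1 h2)
  have hswap : ∑ i, ∑ j ∈ Finset.Iio i, f i j = ∑ i, ∑ j ∈ Finset.Ioi i, f i j := by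
    rw [Finset.sum_comm' (t' := Finset.univ) (s' := fun j => Finset.Ioi j) (by simp)]
    exact Finset.sum_congr rfl fun i _ => Finset.sum_congr rfl fun j _ => hsymm j i
  change _ = ∑ i, ∑ j, f i j
  simp only [hsplit, Finset.sum_add_distrib, hswap]
  rw [two_smul]
  rfl

/-- Contraction of dual bases lets `L` pass from the covector slot to the vector slot: in matrix
entries both sides are the same double sum. Applied once per index, it gives the naturality of
`ι_P`. -/
theorem sum_comp_stdVec {n : ℕ} (f : Covec n →ₗ[ℝ] Coord n →ₗ[ℝ] ℝ) (L : Coord n →L[ℝ] Coord n) :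
    ∑ i, f ((stdCovec i).comp L) (stdVec i) = ∑ i, f (stdCovec i) (L (stdVec i)) := by
  have h1 : ∀ i, f ((stdCovec i).comp L) (stdVec i)
      = ∑ j, stdCovec i (L (stdVec j)) * f (stdCovec j) (stdVec i) := fun i => by
    conv_lhs => rw [covec_eq_sum ((stdCovec i).comp L)]
    simp
  have h2 : ∀ j, f (stdCovec j) (L (stdVec j))
      = ∑ i, stdCovec i (L (stdVec j)) * f (stdCovec j) (stdVec i) := fun j => by
    conv_lhs => rw [← sum_stdCovec_smul_stdVec (L (stdVec j))]
    simp
  simp only [h1, h2]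
  exact Finset.sum_comm

/-- The bilinear form obtained by filling all but the first two slots of a form. -/
def formBilin {n k : ℕ} (Ω : Coord n [⋀^Fin (k + 2)]→L[ℝ] ℝ) (w : Fin k → Coord n) :
    Coord n →ₗ[ℝ] Coord n →ₗ[ℝ] ℝ :=
  LinearMap.mk₂ ℝ (fun A B => interiorVec A (interiorVec B Ω) w)
    (fun A A' B => by rw [interiorVec_add_left]; rfl)
    (fun c A B => by rw [interiorVec_smul_left]; rfl)
    (fun A B B' => by rw [interiorVec_add_left]; rfl)
    (fun c A B => by rw [interiorVec_smul_left]; rfl)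

theorem formBilin_apply {n k : ℕ} (Ω : Coord n [⋀^Fin (k + 2)]→L[ℝ] ℝ) (w : Fin k → Coord n)
    (A B : Coord n) : formBilin Ω w A B = interiorVec A (interiorVec B Ω) w := rfl

/-- Naturality of the interior product with a bivector. -/
theorem interiorBivec_comp {n k : ℕ} (P : Bivec n) (Ω : Coord n [⋀^Fin (k + 2)]→L[ℝ] ℝ)
    (L : Coord n →L[ℝ] Coord n) :
    (interiorBivec (P.compContinuousLinearMap (ContinuousLinearMap.precomp ℝ L)) Ω
      ).compContinuousLinearMap L = interiorBivec P (Ω.compContinuousLinearMap L) := by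
  ext w
  -- Moves `L` from the covectors fed to `P` onto the vectors fed to `Ω`, one index at a time.
  have key : ∀ (p : Covec n →ₗ[ℝ] Covec n →ₗ[ℝ] ℝ) (b : Coord n →ₗ[ℝ] Coord n →ₗ[ℝ] ℝ),
      ∑ i, ∑ j, p ((stdCovec i).comp L) ((stdCovec j).comp L) * b (stdVec i) (stdVec j)
        = ∑ i, ∑ j, p (stdCovec i) (stdCovec j) * b (L (stdVec i)) (L (stdVec j)) := by
    intro p b
    have h1 : ∀ i, ∑ j, p ((stdCovec i).comp L) ((stdCovec j).comp L) * b (stdVec i) (stdVec j)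
        = ∑ j, p ((stdCovec i).comp L) (stdCovec j) * b (stdVec i) (L (stdVec j)) := fun i =>
      sum_comp_stdVec ((LinearMap.mul ℝ ℝ).compl₁₂ (p ((stdCovec i).comp L)) (b (stdVec i))) L
    have h2 : ∀ j, ∑ i, p ((stdCovec i).comp L) (stdCovec j) * b (stdVec i) (L (stdVec j))
        = ∑ i, p (stdCovec i) (stdCovec j) * b (L (stdVec i)) (L (stdVec j)) := fun j =>
      sum_comp_stdVec ((LinearMap.mul ℝ ℝ).compl₁₂ (p.flip (stdCovec j))
        (b.flip (L (stdVec j)))) L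
    simp only [h1]
    rw [Finset.sum_comm]
    simp only [h2]
    exact Finset.sum_comm
  have hL : ∀ A B : Coord n, interiorVec A (interiorVec B (Ω.compContinuousLinearMap L)) w
      = interiorVec (L A) (interiorVec (L B) Ω) (L ∘ w) := by
    intro A B
    simp only [interiorVec_apply, ContinuousAlternatingMap.compContinuousLinearMap_apply]
    congr 1
    ext i : 1
    refine Fin.cases ?_ (fun i => Fin.cases ?_ (fun i => ?_) i) i <;> rfl
  have hP : ∀ i j : Fin n, P.compContinuousLinearMap (ContinuousLinearMap.precomp ℝ L)
      ![stdCovec i, stdCovec j] = P ![(stdCovec i).comp L, (stdCovec j).comp L] := by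
    intro i j
    rw [ContinuousAlternatingMap.compContinuousLinearMap_apply]
    congr 1
    ext a : 1
    fin_cases a <;> rfl
  have e1 := congrArg (fun η => η (L ∘ w)) (two_smul_interiorBivec
    (P.compContinuousLinearMap (ContinuousLinearMap.precomp ℝ L)) Ω)
  have e2 := congrArg (fun η => η w) (two_smul_interiorBivec P (Ω.compContinuousLinearMap L))
  simp only [ContinuousAlternatingMap.smul_apply, ContinuousAlternatingMap.sum_apply, smul_eq_mul,
    hL, hP] at e1 e2
  have := key (bivecBilin P) (formBilin Ω (L ∘ w))
  simp only [bivecBilin_apply, formBilin_apply] at this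
  rw [ContinuousAlternatingMap.compContinuousLinearMap_apply]
  linarith

/-- A top-degree form is determined by its value on the standard basis. -/
theorem topForm_ext {n : ℕ} {Ω Ω' : Coord n [⋀^Fin n]→L[ℝ] ℝ} (h : Ω stdVec = Ω' stdVec) :
    Ω = Ω' := by
  apply ContinuousAlternatingMap.toAlternatingMap_injective
  rw [AlternatingMap.eq_smul_basis_det (EuclideanSpace.basisFun (Fin n) ℝ).toBasis
    Ω.toAlternatingMap, AlternatingMap.eq_smul_basis_det
    (EuclideanSpace.basisFun (Fin n) ℝ).toBasis Ω'.toAlternatingMap, ← stdVec_eq_basis]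
  congr 1

theorem topForm_stdVec_ne_zero {n : ℕ} {Ω : Coord n [⋀^Fin n]→L[ℝ] ℝ} (h : Ω ≠ 0) :
    Ω stdVec ≠ 0 := fun h0 => h (topForm_ext (by simpa using h0))

/-- A form of degree exceeding the dimension vanishes. -/
theorem form_eq_zero_of_lt {n k : ℕ} (h : n < k) (η : Coord n [⋀^Fin k]→L[ℝ] ℝ) : η = 0 := by
  ext v
  refine η.toAlternatingMap.map_linearDependent v fun hv => ?_
  have := hv.fintype_card_le_finrank
  simp at this
  omega

/-- The exterior product `α ∧ η` of a covector with a form. -/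
def covecWedge {n k : ℕ} (α : Covec n) (η : Coord n [⋀^Fin k]→L[ℝ] ℝ) :
    Coord n [⋀^Fin (k + 1)]→L[ℝ] ℝ :=
  ContinuousAlternatingMap.alternatizeUncurryFin (α.smulRight η)

theorem covecWedge_apply {n k : ℕ} (α : Covec n) (η : Coord n [⋀^Fin k]→L[ℝ] ℝ)
    (v : Fin (k + 1) → Coord n) :
    covecWedge α η v = ∑ i : Fin (k + 1), (-1) ^ (i : ℕ) * (α (v i) * η (i.removeNth v)) := by
  simp [covecWedge, ContinuousAlternatingMap.alternatizeUncurryFin_apply]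

theorem covecWedge_smul {n k : ℕ} (α : Covec n) (c : ℝ) (η : Coord n [⋀^Fin k]→L[ℝ] ℝ) :
    covecWedge α (c • η) = c • covecWedge α η := by
  ext v
  simp only [covecWedge_apply, ContinuousAlternatingMap.smul_apply, smul_eq_mul, Finset.mul_sum]
  exact Finset.sum_congr rfl fun i _ => by ring

theorem covecWedge_sum {n k : ℕ} {ι : Type*} (s : Finset ι) (α : Covec n)
    (η : ι → Coord n [⋀^Fin k]→L[ℝ] ℝ) :
    covecWedge α (∑ i ∈ s, η i) = ∑ i ∈ s, covecWedge α (η i) := by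
  ext v
  simp only [covecWedge_apply, ContinuousAlternatingMap.sum_apply, Finset.mul_sum]
  exact Finset.sum_comm

/-- The interior product is an antiderivation. -/
theorem interiorVec_covecWedge {n k : ℕ} (A : Coord n) (α : Covec n)
    (η : Coord n [⋀^Fin (k + 1)]→L[ℝ] ℝ) :
    interiorVec A (covecWedge α η) = α A • η - covecWedge α (interiorVec A η) := by
  ext v
  rw [interiorVec_apply, covecWedge_apply, Fin.sum_univ_succ]
  simp only [ContinuousAlternatingMap.sub_apply, ContinuousAlternatingMap.smul_apply,
    covecWedge_apply]
  rw [sub_eq_add_neg, ← Finset.sum_neg_distrib]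
  congr 1
  · simp
  · refine Finset.sum_congr rfl fun i _ => ?_
    have : i.succ.removeNth (Matrix.vecCons A v) = Matrix.vecCons A (i.removeNth v) := by
      ext j : 1
      refine Fin.cases ?_ (fun j => ?_) j <;> simp [Fin.removeNth]
    rw [this, interiorVec_apply]
    simp [pow_succ]

/-- `α ∧ ι_A Ω = α(A) Ω` for a form of top degree. -/
theorem covecWedge_interiorVec {k : ℕ} (A : Coord (k + 1)) (α : Covec (k + 1))
    (Ω : Coord (k + 1) [⋀^Fin (k + 1)]→L[ℝ] ℝ) :
    covecWedge α (interiorVec A Ω) = α A • Ω := by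
  have h := interiorVec_covecWedge A α Ω
  -- `α ∧ Ω` exceeds the dimension in degree, so the antiderivation rule loses its left-hand side.
  rw [form_eq_zero_of_lt (Nat.lt_succ_self _) (covecWedge α Ω)] at h
  have h0 : interiorVec A (0 : Coord (k + 1) [⋀^Fin (k + 1 + 1)]→L[ℝ] ℝ) = 0 := by ext; simp
  rw [h0] at h
  exact (sub_eq_zero.1 h.symm).symm

theorem covecWedge_interiorVec_interiorVec {k : ℕ} (A B : Coord (k + 2)) (α : Covec (k + 2))
    (Ω : Coord (k + 2) [⋀^Fin (k + 2)]→L[ℝ] ℝ) :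
    covecWedge α (interiorVec A (interiorVec B Ω))
      = α A • interiorVec B Ω - α B • interiorVec A Ω := by
  have h := interiorVec_covecWedge A α (interiorVec B Ω)
  rw [covecWedge_interiorVec, interiorVec_smul_right] at h
  rw [h]
  abel

/-- `α ∧ ι_P Ω = ι_{P^♯ α} Ω` for a form of top degree. -/
theorem covecWedge_interiorBivec {k : ℕ} (P : Bivec (k + 2)) (α : Covec (k + 2))
    (Ω : Coord (k + 2) [⋀^Fin (k + 2)]→L[ℝ] ℝ) :
    covecWedge α (interiorBivec P Ω) = interiorVec (bivecSharp P α) Ω := by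
  -- Doubling replaces the sum over `i < j` by the sum over all pairs, where skew-symmetry can be
  -- used freely.
  have h2 : (2 : ℝ) ≠ 0 := two_ne_zero
  apply smul_right_injective _ h2
  change (2 : ℝ) • _ = (2 : ℝ) • _
  rw [← covecWedge_smul, two_smul_interiorBivec]
  simp only [covecWedge_sum, covecWedge_smul, covecWedge_interiorVec_interiorVec]
  have hs : ∀ α', interiorVec (bivecSharp P α') Ω
      = ∑ j, P ![α', stdCovec j] • interiorVec (stdVec j) Ω := fun α' => by
    simp only [bivecSharp, interiorVec_sum_left, interiorVec_smul_left]
  have hα : ∀ β, P ![α, β] = ∑ i, α (stdVec i) * P ![stdCovec i, β] := fun β => by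
    simp only [← bivecBilin_apply]
    conv_lhs => rw [covec_eq_sum α]
    simp
  rw [hs]
  simp only [hα, smul_sub, Finset.sum_sub_distrib, Finset.sum_smul]
  -- By skew-symmetry the second half of the expansion equals minus the first after relabelling;
  -- subtracting it yields the factor two.
  have e : ∑ i, ∑ j, P ![stdCovec i, stdCovec j] • α (stdVec j) • interiorVec (stdVec i) Ω
      = -∑ j, ∑ i, (α (stdVec i) * P ![stdCovec i, stdCovec j]) • interiorVec (stdVec j) Ω := by
    simp only [← Finset.sum_neg_distrib]
    refine Finset.sum_congr rfl fun i _ => Finset.sum_congr rfl fun j _ => ?_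
    ext w
    rw [bivec_swap]
    simp only [ContinuousAlternatingMap.smul_apply, ContinuousAlternatingMap.neg_apply,
      smul_eq_mul]
    ring
  rw [e, sub_neg_eq_add, two_smul]
  congr 1
  rw [Finset.sum_comm]
  refine Finset.sum_congr rfl fun i _ => Finset.sum_congr rfl fun j _ => ?_
  rw [smul_smul, mul_comm]

/-- Wedging `ι_A Ω` with `β` returns `β(A) Ω`, so every covector value of `A` can be recovered. -/
theorem interiorVec_injective {k : ℕ} {Ω : Coord (k + 1) [⋀^Fin (k + 1)]→L[ℝ] ℝ} (hΩ : Ω ≠ 0)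
    {A B : Coord (k + 1)} (h : interiorVec A Ω = interiorVec B Ω) : A = B := by
  refine coord_ext fun β => ?_
  have := congrArg (covecWedge β) h
  rw [covecWedge_interiorVec, covecWedge_interiorVec] at this
  exact smul_left_injective ℝ hΩ this

/-- A linear endomorphism acts on a top-degree form, as a derivation, by its trace. -/
theorem sum_update_eq_trace {k : ℕ} (Ω : Coord (k + 1) [⋀^Fin (k + 1)]→L[ℝ] ℝ)
    (B : Coord (k + 1) →L[ℝ] Coord (k + 1)) (w : Fin (k + 1) → Coord (k + 1)) :
    ∑ i, Ω (Function.update w i (B (w i))) = (∑ j, stdCovec j (B (stdVec j))) * Ω w := by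
  -- Cramer's rule: this is `α ∧ ι_A Ω = α(A) Ω` evaluated on `w`. The trace then appears by
  -- expanding `B (w i)` in the basis.
  have h1 : ∀ (α : Covec (k + 1)) (A : Coord (k + 1)),
      ∑ i, α (w i) * Ω (Function.update w i A) = α A * Ω w := fun α A => by
    have := congrArg (fun η => η w) (covecWedge_interiorVec A α Ω)
    simp only [covecWedge_apply, ContinuousAlternatingMap.smul_apply, smul_eq_mul] at this
    rw [← this]
    refine Finset.sum_congr rfl fun i _ => ?_
    rw [← Fin.insertNth_removeNth, ContinuousAlternatingMap.map_insertNth, interiorVec_apply]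
    ring
  have h2 : ∀ i, Ω (Function.update w i (B (w i)))
      = ∑ j, (stdCovec j).comp B (w i) * Ω (Function.update w i (stdVec j)) := fun i => by
    conv_lhs => rw [← sum_stdCovec_smul_stdVec (B (w i))]
    refine (Ω.toMultilinearMap.map_update_sum _ i _ w).trans (Finset.sum_congr rfl fun j _ => ?_)
    exact Ω.map_update_smul w i _ _
  simp only [h2]
  rw [Finset.sum_comm]
  simp only [h1, Finset.sum_mul]
  rfl

/-! ### Forms of codegree two and bivectors -/

theorem omitTwo_eq_iff {k : ℕ} {i j : Fin (k + 2)} (h : i < j) (p : Fin (k + 2)) :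
    (∃ l, omitTwo i j h l = p) ↔ p ≠ i ∧ p ≠ j := by
  -- Deleting `j` does not shift the smaller index `i`.
  have hi : j.succAbove (i.castLT (by omega)) = i := by
    rw [Fin.succAbove_of_castSucc_lt]
    · simp
    · simpa using h
  constructor
  · rintro ⟨l, rfl⟩
    refine ⟨fun e => ?_, Fin.succAbove_ne _ _⟩
    rw [omitTwo] at e
    conv_rhs at e => rw [← hi]
    exact Fin.succAbove_ne _ _ (Fin.succAbove_right_injective e)
  · rintro ⟨hpi, hpj⟩
    obtain ⟨q, rfl⟩ := Fin.exists_succAbove_eq hpj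
    have hq : q ≠ (i.castLT (by omega) : Fin (k + 1)) := by
      rintro rfl
      exact hpi hi
    obtain ⟨l, rfl⟩ := Fin.exists_succAbove_eq hq
    exact ⟨l, rfl⟩

/-- A form of codegree two is determined by its coefficients. -/
theorem codegreeTwo_ext {k : ℕ} {η η' : Coord (k + 2) [⋀^Fin k]→L[ℝ] ℝ}
    (h : ∀ i j (hij : i < j), η (fun l => stdVec (omitTwo i j hij l))
      = η' (fun l => stdVec (omitTwo i j hij l))) : η = η' := by
  apply ContinuousAlternatingMap.toAlternatingMap_injective
  refine Module.Basis.ext_alternating (EuclideanSpace.basisFun (Fin (k + 2)) ℝ).toBasis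
    fun v hv => ?_
  simp only [← stdVec_eq_basis]
  -- An injective choice of `k` among `k + 2` indices misses exactly two, so it is a permutation of
  -- the increasing enumeration `omitTwo`; the permutation only contributes a common sign.
  have hcard : (Finset.univ.image v)ᶜ.card = 2 := by
    rw [Finset.card_compl, Finset.card_image_of_injective _ hv]
    simp
  obtain ⟨x, y, hxy, hc⟩ := Finset.card_eq_two.1 hcard
  have main : ∀ x y, x < y → (∀ l, v l ≠ x ∧ v l ≠ y) →
      η (fun l => stdVec (v l)) = η' (fun l => stdVec (v l)) := by
    intro x y hxy hv'
    choose σ hσ using fun l => (omitTwo_eq_iff hxy (v l)).2 (hv' l)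
    have hinj : Function.Injective σ := fun a b hab => hv (by rw [← hσ a, ← hσ b, hab])
    let e : Equiv.Perm (Fin k) := Equiv.ofBijective σ (Finite.injective_iff_bijective.1 hinj)
    have hve : (fun l => stdVec (v l)) = (fun l => stdVec (omitTwo x y hxy l)) ∘ e := by
      ext1 l
      simp only [Function.comp, e, Equiv.ofBijective_apply, hσ]
    have p1 := η.toAlternatingMap.map_perm (fun l => stdVec (omitTwo x y hxy l)) e
    have p2 := η'.toAlternatingMap.map_perm (fun l => stdVec (omitTwo x y hxy l)) e
    simp only [ContinuousAlternatingMap.coe_toAlternatingMap] at p1 p2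
    rw [hve, p1, p2, h]
  have hmem : ∀ l, v l ≠ x ∧ v l ≠ y := fun l => by
    have : v l ∉ (Finset.univ.image v)ᶜ := by simp
    rw [hc] at this
    simpa using this
  rcases lt_or_gt_of_ne hxy with hlt | hlt
  · exact main x y hlt hmem
  · exact main y x hlt fun l => (hmem l).symm

/-- The coefficients of `ι_P Ω` for a top-degree form `Ω`. -/
theorem interiorBivec_apply_omitTwo {k : ℕ} (P : Bivec (k + 2))
    (Ω : Coord (k + 2) [⋀^Fin (k + 2)]→L[ℝ] ℝ) {i j : Fin (k + 2)} (h : i < j) :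
    interiorBivec P Ω (fun l => stdVec (omitTwo i j h l))
      = (-1) ^ (i : ℕ) * (-1) ^ (j : ℕ) * P ![stdCovec i, stdCovec j] * Ω stdVec := by
  have hi : j.succAbove (i.castLT (by omega)) = i := by
    rw [Fin.succAbove_of_castSucc_lt]
    · simp
    · simpa using h
  have h0 : ∀ p q : Fin (k + 2), p < q → (p, q) ≠ (i, j) →
      Ω (Matrix.vecCons (stdVec q) (Matrix.vecCons (stdVec p)
        (fun l => stdVec (omitTwo i j h l)))) = 0 := by
    intro p q hpq hne
    -- Unless `(p, q) = (i, j)`, one of `p, q` lies among the remaining indices, and the alternating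
    -- form sees a repeated vector.
    have hor : (p ≠ i ∧ p ≠ j) ∨ (q ≠ i ∧ q ≠ j) := by
      by_contra hcon
      rw [Ne, Prod.mk.injEq] at hne
      grind
    rcases hor with hp | hq
    · obtain ⟨l, hl⟩ := (omitTwo_eq_iff h p).2 hp
      refine Ω.map_eq_zero_of_eq _ (i := 1) (j := l.succ.succ) ?_ (by simp [Fin.ext_iff])
      simp [hl]
    · obtain ⟨l, hl⟩ := (omitTwo_eq_iff h q).2 hq
      refine Ω.map_eq_zero_of_eq _ (i := 0) (j := l.succ.succ) ?_ (by simp [Fin.ext_iff])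
      simp [hl]
  have h1 : Ω (Matrix.vecCons (stdVec j) (Matrix.vecCons (stdVec i)
      (fun l => stdVec (omitTwo i j h l)))) = (-1) ^ (i : ℕ) * (-1) ^ (j : ℕ) * Ω stdVec := by
    have e1 : (i.castLT (by omega) : Fin (k + 1)).insertNth (stdVec i)
        (fun l => stdVec (omitTwo i j h l)) = j.removeNth (stdVec : Fin (k + 2) → Coord (k + 2)) := by
      conv_rhs => rw [← Fin.insertNth_self_removeNth (i.castLT (by omega) : Fin (k + 1))
        (j.removeNth (stdVec : Fin (k + 2) → Coord (k + 2)))]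
      congr 1
      simp only [Fin.removeNth, hi]
    have e2 : j.insertNth (stdVec j) (j.removeNth (stdVec : Fin (k + 2) → Coord (k + 2))) = stdVec :=
      Fin.insertNth_self_removeNth _ _
    -- Moving `e_j` and then `e_i` to the front of the standard frame costs `(-1)^j` and `(-1)^i`.
    -- The vector `e_j` ends up first because `ι_{e_i} ι_{e_j}` fills the first slot with `e_j`.
    have e3 : Ω stdVec = (-1) ^ (j : ℕ) * ((-1) ^ (i : ℕ) * Ω (Matrix.vecCons (stdVec j)
        (Matrix.vecCons (stdVec i) (fun l => stdVec (omitTwo i j h l))))) := by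
      conv_lhs => rw [← e2, ← e1]
      rw [ContinuousAlternatingMap.map_insertNth, ← interiorVec_apply (stdVec j) Ω,
        ContinuousAlternatingMap.map_insertNth]
      simp [zsmul_eq_mul]
    rw [e3]
    have s1 : ((-1 : ℝ) ^ (i : ℕ)) * (-1) ^ (i : ℕ) = 1 := by rw [← mul_pow]; simp
    have s2 : ((-1 : ℝ) ^ (j : ℕ)) * (-1) ^ (j : ℕ) = 1 := by rw [← mul_pow]; simp
    rw [show ∀ a b c : ℝ, a * b * (b * (a * c)) = (a * a) * (b * b) * c by intros; ring, s1, s2]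
    simp
  simp only [interiorBivec, ContinuousAlternatingMap.sum_apply,
    ContinuousAlternatingMap.smul_apply, interiorVec_apply, smul_eq_mul]
  rw [Finset.sum_eq_single i, Finset.sum_eq_single j, h1]
  · ring
  · intro q hq hqj
    rw [h0 i q (Finset.mem_Ioi.1 hq) (by simp [hqj]), mul_zero]
  · intro hj
    exact absurd (Finset.mem_Ioi.2 h) hj
  · intro p _ hpi
    refine Finset.sum_eq_zero fun q hq => ?_
    rw [h0 p q (Finset.mem_Ioi.1 hq) (by simp [hpi]), mul_zero]
  · simp

theorem interiorBivec_injective {k : ℕ} {Ω : Coord (k + 2) [⋀^Fin (k + 2)]→L[ℝ] ℝ} (hΩ : Ω ≠ 0)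
    {P Q : Bivec (k + 2)} (h : interiorBivec P Ω = interiorBivec Q Ω) : P = Q := by
  refine bivec_ext_stdCovec fun i j hij => ?_
  have := congrArg (fun η => η (fun l => stdVec (omitTwo i j hij l))) h
  simp only [interiorBivec_apply_omitTwo] at this
  have h1 := mul_right_cancel₀ (topForm_stdVec_ne_zero hΩ) this
  exact mul_left_cancel₀ (by positivity) h1

/-- The bivector with prescribed coefficients. -/
def bivecOfCoeff {n : ℕ} (c : Fin n → Fin n → ℝ) : Bivec n :=
  ∑ i, ∑ j ∈ Finset.Ioi i, c i j • wedgeVec (stdVec i) (stdVec j)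

theorem bivecOfCoeff_apply {n : ℕ} (c : Fin n → Fin n → ℝ) {i j : Fin n} (h : i < j) :
    bivecOfCoeff c ![stdCovec i, stdCovec j] = c i j := by
  simp only [bivecOfCoeff, ContinuousAlternatingMap.sum_apply,
    ContinuousAlternatingMap.smul_apply, wedgeVec_apply, stdCovec_stdVec, smul_eq_mul]
  rw [Finset.sum_eq_single i, Finset.sum_eq_single j]
  · simp [h.ne']
  · intro q hq hqj
    have : i < q := Finset.mem_Ioi.1 hq
    simp [hqj.symm, this.ne]
  · intro hj
    exact absurd (Finset.mem_Ioi.2 h) hj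
  · intro p _ hpi
    refine Finset.sum_eq_zero fun q hq => ?_
    have hpq : p < q := Finset.mem_Ioi.1 hq
    have : ¬ (j = p ∧ i = q) := fun hh => by
      rw [← hh.1, ← hh.2] at hpq
      exact lt_asymm h hpq
    rw [if_neg hpi.symm]
    by_cases hjp : j = p
    · rw [if_neg fun hiq => this ⟨hjp, hiq⟩]
      simp
    · simp [hjp]
  · simp

/-- The interior product of a bivector with a top-degree form, as a linear map. -/
def interiorBivecHom {k : ℕ} (Ω : Coord (k + 2) [⋀^Fin (k + 2)]→L[ℝ] ℝ) :
    Bivec (k + 2) →ₗ[ℝ] Coord (k + 2) [⋀^Fin k]→L[ℝ] ℝ where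
  toFun P := interiorBivec P Ω
  map_add' P Q := interiorBivec_add_left P Q Ω
  map_smul' c P := interiorBivec_smul_left c P Ω

/-- The coefficient formula for `ι_P Ω` is solved for `P`; the value `0` for `i ≥ j` is never read,
because `bivecOfCoeff` sums over `i < j`. -/
theorem interiorBivec_surjective {k : ℕ} {Ω : Coord (k + 2) [⋀^Fin (k + 2)]→L[ℝ] ℝ} (hΩ : Ω ≠ 0)
    (η : Coord (k + 2) [⋀^Fin k]→L[ℝ] ℝ) : ∃ P, interiorBivec P Ω = η := by
  refine ⟨bivecOfCoeff fun i j => if h : i < j then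
    (-1) ^ (i : ℕ) * (-1) ^ (j : ℕ) * (Ω stdVec)⁻¹ * η (fun l => stdVec (omitTwo i j h l)) else 0,
    codegreeTwo_ext fun i j h => ?_⟩
  rw [interiorBivec_apply_omitTwo, bivecOfCoeff_apply _ h, dif_pos h]
  have s1 : ((-1 : ℝ) ^ (i : ℕ)) * (-1) ^ (i : ℕ) = 1 := by rw [← mul_pow]; simp
  have s2 : ((-1 : ℝ) ^ (j : ℕ)) * (-1) ^ (j : ℕ) = 1 := by rw [← mul_pow]; simp
  have s3 := inv_mul_cancel₀ (topForm_stdVec_ne_zero hΩ)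
  rw [show ∀ a b c d e : ℝ, a * b * (a * b * c * e) * d = (a * a) * (b * b) * (c * d) * e by
    intros; ring, s1, s2, s3]
  simp

/-- Contraction with a nonzero top-degree form identifies bivectors with forms of codegree two. -/
def interiorBivecEquiv {k : ℕ} (Ω : Coord (k + 2) [⋀^Fin (k + 2)]→L[ℝ] ℝ) (hΩ : Ω ≠ 0) :
    Bivec (k + 2) ≃ₗ[ℝ] Coord (k + 2) [⋀^Fin k]→L[ℝ] ℝ :=
  LinearEquiv.ofBijective (interiorBivecHom Ω)
    ⟨fun _ _ h => interiorBivec_injective hΩ h, fun η => interiorBivec_surjective hΩ η⟩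

/-! ### Rank -/

/-- The matrix of a bivector. -/
def bivecMatrix {n : ℕ} (P : Bivec n) : Matrix (Fin n) (Fin n) ℝ :=
  Matrix.of fun i j => P ![stdCovec i, stdCovec j]

/-- The skew-symmetric matrix of the coefficients of a form of codegree two. -/
def codegreeTwoMatrix {k : ℕ} (η : Coord (k + 2) [⋀^Fin k]→L[ℝ] ℝ) :
    Matrix (Fin (k + 2)) (Fin (k + 2)) ℝ :=
  Matrix.of fun i j =>
    if h : i < j then η (fun l => stdVec (omitTwo i j h l))
    else if h : j < i then -η (fun l => stdVec (omitTwo j i h l))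
    else 0

/-- The two coefficient matrices differ by diagonal factors: alternating signs and the scalar `c /
Ω(e)`. Only an inequality holds in general, since `c` may vanish. -/
theorem rank_bivecMatrix_le {k : ℕ} {Ω : Coord (k + 2) [⋀^Fin (k + 2)]→L[ℝ] ℝ} (hΩ : Ω ≠ 0)
    {P : Bivec (k + 2)} {η : Coord (k + 2) [⋀^Fin k]→L[ℝ] ℝ} {c : ℝ}
    (h : interiorBivec P Ω = c • η) :
    (bivecMatrix P).rank ≤ (codegreeTwoMatrix η).rank := by
  have hΩ' := topForm_stdVec_ne_zero hΩ
  have hlt : ∀ i j (hij : i < j), P ![stdCovec i, stdCovec j]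
      = c / Ω stdVec * (-1) ^ (i : ℕ) * η (fun l => stdVec (omitTwo i j hij l))
        * (-1) ^ (j : ℕ) := fun i j hij => by
    have h1 := congrArg (fun η => η (fun l => stdVec (omitTwo i j hij l))) h
    simp only [interiorBivec_apply_omitTwo, ContinuousAlternatingMap.smul_apply,
      smul_eq_mul] at h1
    have s1 : ((-1 : ℝ) ^ (i : ℕ)) * (-1) ^ (i : ℕ) = 1 := by rw [← mul_pow]; simp
    have s2 : ((-1 : ℝ) ^ (j : ℕ)) * (-1) ^ (j : ℕ) = 1 := by rw [← mul_pow]; simp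
    rw [show c / Ω stdVec * (-1) ^ (i : ℕ) * η (fun l => stdVec (omitTwo i j hij l))
      * (-1) ^ (j : ℕ) = (c * η (fun l => stdVec (omitTwo i j hij l))) * ((-1) ^ (i : ℕ)
      * (-1) ^ (j : ℕ) / Ω stdVec) by ring, ← h1]
    field_simp
    rw [sq, sq, s1, s2]
    ring
  have heq : bivecMatrix P = Matrix.diagonal (fun i : Fin (k + 2) => c / Ω stdVec * (-1) ^ (i : ℕ))
      * codegreeTwoMatrix η * Matrix.diagonal (fun j : Fin (k + 2) => (-1) ^ (j : ℕ)) := by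
    ext i j
    rw [Matrix.mul_diagonal, Matrix.diagonal_mul]
    simp only [bivecMatrix, codegreeTwoMatrix, Matrix.of_apply]
    rcases lt_trichotomy i j with hij | rfl | hij
    · rw [dif_pos hij, hlt i j hij]
    · rw [bivec_self]
      simp
    · rw [dif_neg hij.not_gt, dif_pos hij, bivec_swap, hlt j i hij]
      ring
  rw [heq]
  exact (Matrix.rank_mul_le_left _ _).trans (Matrix.rank_mul_le_right _ _)

/-- The Plücker relation for bivectors of rank at most two. -/
theorem bivec_pluecker {n : ℕ} {P : Bivec n} (h : (bivecMatrix P).rank ≤ 2)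
    (α β γ δ : Covec n) :
    P ![α, δ] * P ![β, γ] + P ![β, δ] * P ![γ, α] + P ![γ, δ] * P ![α, β] = 0 := by
  set v : Fin 4 → Covec n := ![α, β, γ, δ] with hv
  set N : Matrix (Fin 4) (Fin 4) ℝ := Matrix.of fun a b => P ![v a, v b] with hN
  set A : Matrix (Fin 4) (Fin n) ℝ := Matrix.of fun a i => v a (stdVec i) with hA
  have hNA : N = A * bivecMatrix P * A.transpose := by
    ext a b
    simp only [hN, Matrix.of_apply, Matrix.mul_apply, Matrix.transpose_apply, hA, bivecMatrix]
    rw [bivec_eq_sum, Finset.sum_comm]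
    refine Finset.sum_congr rfl fun j _ => ?_
    rw [Finset.sum_mul]
    exact Finset.sum_congr rfl fun i _ => by ring
  -- The Gram matrix `N` of the four covectors factors through the matrix of `P`, so its rank is at
  -- most two, whereas an invertible one would have rank four.
  have hdet : N.det = 0 := by
    by_contra hne
    have h4 := Matrix.rank_of_det_ne_zero hne
    have : N.rank ≤ 2 := by
      rw [hNA]
      exact ((Matrix.rank_mul_le_left _ _).trans (Matrix.rank_mul_le_right _ _)).trans h
    simp at h4
    omega
  -- The determinant of a skew `4 × 4` matrix is the square of its Pfaffian, and the Pfaffian of `N`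
  -- is the Plücker expression.
  have hpf : N.det = (P ![α, δ] * P ![β, γ] + P ![β, δ] * P ![γ, α]
      + P ![γ, δ] * P ![α, β]) ^ 2 := by
    have e : N = !![0, P ![α, β], P ![α, γ], P ![α, δ];
        -P ![α, β], 0, P ![β, γ], P ![β, δ];
        -P ![α, γ], -P ![β, γ], 0, P ![γ, δ];
        -P ![α, δ], -P ![β, δ], -P ![γ, δ], 0] := by
      simp only [← bivec_swap P]
      simp only [← bivec_self P α]
      ext a b
      fin_cases a <;> fin_cases b <;> simp [hN, hv, bivec_self]
    rw [e, bivec_swap P α γ]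
    simp [Matrix.det_succ_row_zero, Fin.sum_univ_succ, Fin.succAbove]
    ring
  rw [hdet] at hpf
  exact pow_eq_zero_iff two_ne_zero |>.1 hpf.symm

/-- In coordinates `P^♯` is multiplication by the transposed matrix of `P`, and transposition
preserves rank. -/
theorem finrank_range_le_rank_bivecMatrix {n : ℕ} (P : Bivec n)
    (f : Covec n →ₗ[ℝ] Coord n) (hf : ∀ α, f α = bivecSharp P α) :
    Module.finrank ℝ (LinearMap.range f) ≤ (bivecMatrix P).rank := by
  let g : Covec n →ₗ[ℝ] (Fin n → ℝ) := LinearMap.pi fun i =>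
    (ContinuousLinearMap.apply ℝ ℝ (stdVec i)).toLinearMap
  let e : (Fin n → ℝ) →ₗ[ℝ] Coord n := (EuclideanSpace.equiv (Fin n) ℝ).symm.toLinearMap
  have hfe : f = e ∘ₗ (bivecMatrix P).transpose.mulVecLin ∘ₗ g := by
    ext α j
    have h1 : (f α) j = ∑ i, α (stdVec i) * P ![stdCovec i, stdCovec j] := by
      rw [hf, ← stdCovec_apply, apply_bivecSharp]
      simp only [← bivecBilin_apply]
      conv_lhs => rw [covec_eq_sum α]
      simp
    rw [h1]
    simp only [LinearMap.comp_apply, e, g, bivecMatrix]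
    change _ = ∑ i : Fin n, _ * _
    refine Finset.sum_congr rfl fun i _ => ?_
    simp [mul_comm]
  rw [hfe, ← Matrix.rank_transpose, LinearMap.range_comp, LinearMap.range_comp]
  refine (Submodule.finrank_map_le _ _).trans ?_
  refine Submodule.finrank_mono ?_
  rintro _ ⟨v, _, rfl⟩
  exact ⟨v, rfl⟩

/-! ### Calculus on the coordinate space -/

instance finiteDimensional_bivec (n : ℕ) : FiniteDimensional ℝ (Bivec n) :=
  FiniteDimensional.of_injective
    ({  toFun := fun P i j => P ![stdCovec i, stdCovec j]
        map_add' := fun _ _ => rfl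
        map_smul' := fun _ _ => rfl } : Bivec n →ₗ[ℝ] Fin n → Fin n → ℝ)
    fun _ _ h => bivec_ext_stdCovec fun i j _ => congrFun (congrFun h i) j

theorem hasFDerivAt_clm_comp {E G H : Type*} [NormedAddCommGroup E] [NormedSpace ℝ E]
    [NormedAddCommGroup G] [NormedSpace ℝ G] [NormedAddCommGroup H] [NormedSpace ℝ H]
    (T : G →L[ℝ] H) {f : E → G} {d : E →L[ℝ] G} {y : E} (h : HasFDerivAt f d y) :
    HasFDerivAt (fun z => T (f z)) (T.comp d) y :=
  T.hasFDerivAt.comp y h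

theorem hasFDerivAt_fun_smul {E G : Type*} [NormedAddCommGroup E] [NormedSpace ℝ E]
    [NormedAddCommGroup G] [NormedSpace ℝ G] {c : E → ℝ} {f : E → G} {y : E}
    (hc : DifferentiableAt ℝ c y) (hf : DifferentiableAt ℝ f y) :
    HasFDerivAt (fun z => c z • f z)
      (c y • fderiv ℝ f y + (fderiv ℝ c y).smulRight (f y)) y :=
  hc.hasFDerivAt.smul hf.hasFDerivAt

theorem hasFDerivAt_bivec_apply {n : ℕ} {E : Type*} [NormedAddCommGroup E] [NormedSpace ℝ E]
    {P : E → Bivec n} {d : E →L[ℝ] Bivec n} {y : E} (h : HasFDerivAt P d y) (α β : Covec n) :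
    HasFDerivAt (fun z => P z ![α, β])
      ((ContinuousAlternatingMap.apply ℝ (Covec n) ℝ ![α, β]).comp d) y :=
  hasFDerivAt_clm_comp (G := Bivec n) (ContinuousAlternatingMap.apply ℝ (Covec n) ℝ ![α, β]) h

/-- The divergence of a bivector field on the coordinate space. -/
def bivecDiv {n : ℕ} (P : Coord n → Bivec n) (y : Coord n) : Coord n :=
  ∑ i, bivecSharp (fderiv ℝ P y (stdVec i)) (stdCovec i)

theorem apply_bivecDiv {n : ℕ} (P : Coord n → Bivec n) (y : Coord n) (α : Covec n) :
    ∑ i, fderiv ℝ P y (stdVec i) ![α, stdCovec i] = -α (bivecDiv P y) := by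
  simp only [bivecDiv, map_sum, apply_bivecSharp, ← Finset.sum_neg_distrib]
  exact Finset.sum_congr rfl fun i _ => bivec_swap _ _ _

theorem fderiv_eq_sum_smulRight {n : ℕ} {F : Type*} [NormedAddCommGroup F] [NormedSpace ℝ F]
    (L : Coord n →L[ℝ] F) : L = ∑ i, (stdCovec i).smulRight (L (stdVec i)) := by
  ext v
  conv_lhs => rw [← sum_stdCovec_smul_stdVec v]
  simp

/-- The exterior derivative of `ι_P vol` is the contraction of `vol` with the divergence of `P`. -/
theorem extDeriv_interiorBivec {k : ℕ} (vol : Coord (k + 2) [⋀^Fin (k + 2)]→L[ℝ] ℝ)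
    {P : Coord (k + 2) → Bivec (k + 2)} {y : Coord (k + 2)} (hP : DifferentiableAt ℝ P y) :
    extDeriv (fun z => interiorBivec (P z) vol) y = interiorVec (bivecDiv P y) vol := by
  have h' : fderiv ℝ (fun z => interiorBivec (P z) vol) y
      = (interiorBivecHom vol).toContinuousLinearMap.comp (fderiv ℝ P y) :=
    (hasFDerivAt_clm_comp (G := Bivec (k + 2)) (interiorBivecHom vol).toContinuousLinearMap
      hP.hasFDerivAt).fderiv
  -- Since `vol` is constant, `d(ι_P vol) = ∑ dx^i ∧ ι_{∂_i P} vol`, and each summand is the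
  -- contraction with `(∂_i P)^♯ dx^i`.
  rw [extDeriv, h', fderiv_eq_sum_smulRight ((interiorBivecHom vol).toContinuousLinearMap.comp
    (fderiv ℝ P y)), ← ContinuousAlternatingMap.alternatizeUncurryFinCLM_apply, map_sum, bivecDiv,
    interiorVec_sum_left]
  refine Finset.sum_congr rfl fun i _ => ?_
  rw [ContinuousAlternatingMap.alternatizeUncurryFinCLM_apply]
  exact covecWedge_interiorBivec _ _ _

theorem extDeriv_fun_smul_form {n k : ℕ} {f : Coord n → ℝ} {η : Coord n → Coord n [⋀^Fin k]→L[ℝ] ℝ}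
    {y : Coord n} (hf : DifferentiableAt ℝ f y) (hη : DifferentiableAt ℝ η y) :
    extDeriv (fun z => f z • η z) y = covecWedge (fderiv ℝ f y) (η y) + f y • extDeriv η y := by
  rw [extDeriv, fderiv_fun_smul hf hη, ContinuousAlternatingMap.alternatizeUncurryFin_add,
    ContinuousAlternatingMap.alternatizeUncurryFin_smul]
  exact add_comm _ _

/-- A bivector field satisfying the Plücker relations that is divergence-free with respect to a
density has vanishing Schouten bracket with itself. -/
theorem sum_cyclic_eq_zero_of_bivecDiv_eq_zero {n : ℕ} {ρ : Coord n → ℝ} {P : Coord n → Bivec n}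
    {y : Coord n} (hρ : DifferentiableAt ℝ ρ y) (hP : DifferentiableAt ℝ P y) (hρ0 : ρ y ≠ 0)
    (hdiv : bivecDiv (fun z => ρ z • P z) y = 0)
    (hpl : ∀ᶠ z in nhds y, ∀ α β γ δ,
      P z ![α, δ] * P z ![β, γ] + P z ![β, δ] * P z ![γ, α] + P z ![γ, δ] * P z ![α, β] = 0)
    (α β γ : Covec n) :
    fderiv ℝ P y (bivecSharp (P y) α) ![β, γ] + fderiv ℝ P y (bivecSharp (P y) β) ![γ, α]
      + fderiv ℝ P y (bivecSharp (P y) γ) ![α, β] = 0 := by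
  have hD : DifferentiableAt ℝ (fun z => ρ z • P z) y := 
    (hasFDerivAt_fun_smul (G := Bivec n) hρ hP).differentiableAt
  set D := fderiv ℝ (fun z => ρ z • P z) y with hDdef
  set d := fderiv ℝ P y with hd
  -- The `∂_l`-derivative of `ρ` times the Plücker relation with `δ = dx^l`; the density is kept
  -- with the factor containing `dx^l`, so that summing over `l` produces the divergence of `ρP`.
  have key : ∀ l, (D (stdVec l) ![α, stdCovec l] * P y ![β, γ]
        + ρ y * (P y ![α, stdCovec l] * d (stdVec l) ![β, γ]))
      + (D (stdVec l) ![β, stdCovec l] * P y ![γ, α]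
        + ρ y * (P y ![β, stdCovec l] * d (stdVec l) ![γ, α]))
      + (D (stdVec l) ![γ, stdCovec l] * P y ![α, β]
        + ρ y * (P y ![γ, stdCovec l] * d (stdVec l) ![α, β])) = 0 := by
    intro l
    have hz : (fun z => (ρ z • P z) ![α, stdCovec l] * P z ![β, γ]
        + (ρ z • P z) ![β, stdCovec l] * P z ![γ, α]
        + (ρ z • P z) ![γ, stdCovec l] * P z ![α, β]) =ᶠ[nhds y] fun _ => 0 := by
      filter_upwards [hpl] with z hz
      have := hz α β γ (stdCovec l)
      simp only [ContinuousAlternatingMap.smul_apply, smul_eq_mul]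
      linear_combination ρ z * this
    have h1 := fun a b => hasFDerivAt_bivec_apply hD.hasFDerivAt a b
    have h2 := fun a b => hasFDerivAt_bivec_apply hP.hasFDerivAt a b
    have h3 := (((h1 α (stdCovec l)).mul (h2 β γ)).add ((h1 β (stdCovec l)).mul (h2 γ α))).add
      ((h1 γ (stdCovec l)).mul (h2 α β))
    have h4 := h3.unique ((hasFDerivAt_const (0 : ℝ) y).congr_of_eventuallyEq hz)
    have h5 := congrArg (fun L => L (stdVec l)) h4
    simp only [_root_.add_apply, _root_.smul_apply,
      ContinuousLinearMap.comp_apply, ContinuousAlternatingMap.apply_apply, smul_eq_mul,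
      ContinuousAlternatingMap.smul_apply, _root_.zero_apply] at h5
    rw [← hDdef, ← hd] at h5
    linear_combination h5
  have hsum := Finset.sum_eq_zero fun l (_ : l ∈ Finset.univ) => key l
  simp only [Finset.sum_add_distrib, ← Finset.sum_mul, ← Finset.mul_sum] at hsum
  have hD0 : ∀ α, ∑ l, D (stdVec l) ![α, stdCovec l] = 0 := fun α => by
    rw [hDdef, apply_bivecDiv, hdiv, map_zero, neg_zero]
  have hsharp : ∀ α β γ, d (bivecSharp (P y) α) ![β, γ]
      = ∑ l, P y ![α, stdCovec l] * d (stdVec l) ![β, γ] := fun α β γ => by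
    simp [bivecSharp, map_sum, ContinuousAlternatingMap.sum_apply]
  simp only [hD0, ← hsharp] at hsum
  have := mul_eq_zero.1 (show ρ y * (d (bivecSharp (P y) α) ![β, γ]
    + d (bivecSharp (P y) β) ![γ, α] + d (bivecSharp (P y) γ) ![α, β]) = 0 by linarith)
  exact this.resolve_left hρ0

theorem bivecSharp_fderiv_differentiableAt {n : ℕ} {P : Coord n → Bivec n} {H : Coord n → ℝ}
    {y : Coord n} (hP : DifferentiableAt ℝ P y) (hH : DifferentiableAt ℝ (fderiv ℝ H) y) :
    DifferentiableAt ℝ (fun z => bivecSharp (P z) (fderiv ℝ H z)) y := by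
  have : (fun z => bivecSharp (P z) (fderiv ℝ H z)) = fun z => ∑ i,
      (∑ j, fderiv ℝ H z (stdVec j) * P z ![stdCovec j, stdCovec i]) • stdVec i := by
    ext1 z
    rw [bivecSharp]
    refine Finset.sum_congr rfl fun i _ => ?_
    congr 1
    simp only [← bivecBilin_apply]
    conv_lhs => rw [covec_eq_sum (fderiv ℝ H z)]
    simp
  rw [this]
  refine DifferentiableAt.fun_sum fun i _ => DifferentiableAt.smul_const
    (DifferentiableAt.fun_sum fun j _ => DifferentiableAt.fun_mul ?_ ?_) _
  · exact hH.clm_apply (differentiableAt_const _)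
  · exact (hasFDerivAt_bivec_apply hP.hasFDerivAt _ _).differentiableAt

/-- Hamiltonian vector fields of a bivector field that is divergence-free with respect to a density
are divergence-free with respect to that density. -/
theorem divergence_hamiltonian {n : ℕ} {ρ : Coord n → ℝ} {P : Coord n → Bivec n} {H : Coord n → ℝ}
    {y : Coord n} (hρ : DifferentiableAt ℝ ρ y) (hP : DifferentiableAt ℝ P y)
    (hH : ContDiffAt ℝ 2 H y) (hdiv : bivecDiv (fun z => ρ z • P z) y = 0) :
    fderiv ℝ ρ y (bivecSharp (P y) (fderiv ℝ H y)) + ρ y * ∑ i, stdCovec i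
      (fderiv ℝ (fun z => bivecSharp (P z) (fderiv ℝ H z)) y (stdVec i)) = 0 := by
  have hH' : DifferentiableAt ℝ (fderiv ℝ H) y :=
    (hH.fderiv_right (m := 1) (by norm_num)).differentiableAt one_ne_zero
  have hZ := bivecSharp_fderiv_differentiableAt hP hH'
  set H2 := fderiv ℝ (fderiv ℝ H) y with hH2
  have hsymm : ∀ v w, H2 v w = H2 w v := fun v w =>
    (hH.isSymmSndFDerivAt (by simp)).eq v w
  have hcomp : ∀ i, stdCovec i (fderiv ℝ (fun z => bivecSharp (P z) (fderiv ℝ H z)) y (stdVec i))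
      = ∑ j, (fderiv ℝ H y (stdVec j) * fderiv ℝ P y (stdVec i) ![stdCovec j, stdCovec i]
        + H2 (stdVec i) (stdVec j) * P y ![stdCovec j, stdCovec i]) := by
    intro i
    have e1 : HasFDerivAt (fun z => stdCovec i (bivecSharp (P z) (fderiv ℝ H z)))
        ((stdCovec i).comp (fderiv ℝ (fun z => bivecSharp (P z) (fderiv ℝ H z)) y)) y :=
      (stdCovec i).hasFDerivAt.comp y hZ.hasFDerivAt
    have e2 : (fun z => stdCovec i (bivecSharp (P z) (fderiv ℝ H z)))
        = fun z => ∑ j, fderiv ℝ H z (stdVec j) * P z ![stdCovec j, stdCovec i] := by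
      ext1 z
      rw [apply_bivecSharp]
      simp only [← bivecBilin_apply]
      conv_lhs => rw [covec_eq_sum (fderiv ℝ H z)]
      simp
    rw [e2] at e1
    have e3 := HasFDerivAt.fun_sum (u := Finset.univ) fun j (_ : j ∈ Finset.univ) =>
      (hH'.hasFDerivAt.clm_apply (hasFDerivAt_const (stdVec j) y)).mul
        (hasFDerivAt_bivec_apply hP.hasFDerivAt (stdCovec j) (stdCovec i))
    have e4 := congrArg (fun L => L (stdVec i)) (e1.unique e3)
    simp only [ContinuousLinearMap.comp_apply] at e4
    rw [e4]
    simp [mul_comm, hH2]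
  -- A symmetric Hessian contracted with a skew bivector.
  have hanti : ∑ i, ∑ j, H2 (stdVec i) (stdVec j) * P y ![stdCovec j, stdCovec i] = 0 := by
    have : ∑ i, ∑ j, H2 (stdVec i) (stdVec j) * P y ![stdCovec j, stdCovec i]
        = -∑ i, ∑ j, H2 (stdVec i) (stdVec j) * P y ![stdCovec j, stdCovec i] := by
      conv_lhs => rw [Finset.sum_comm]
      simp only [← Finset.sum_neg_distrib]
      refine Finset.sum_congr rfl fun i _ => Finset.sum_congr rfl fun j _ => ?_
      rw [hsymm, bivec_swap]
      ring
    linarith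
  have hD : ∀ i, fderiv ℝ (fun z => ρ z • P z) y (stdVec i)
      = ρ y • fderiv ℝ P y (stdVec i) + fderiv ℝ ρ y (stdVec i) • P y := fun i => by
    rw [(hasFDerivAt_fun_smul (G := Bivec n) hρ hP).fderiv]
    rfl
  have hdiv' := apply_bivecDiv (fun z => ρ z • P z) y (fderiv ℝ H y)
  rw [hdiv, map_zero, neg_zero] at hdiv'
  simp only [hD, ContinuousAlternatingMap.add_apply, ContinuousAlternatingMap.smul_apply,
    smul_eq_mul, Finset.sum_add_distrib, ← Finset.mul_sum] at hdiv'
  have hexp : ∀ i, ∑ j, fderiv ℝ H y (stdVec j) * fderiv ℝ P y (stdVec i) ![stdCovec j, stdCovec i]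
      = fderiv ℝ P y (stdVec i) ![fderiv ℝ H y, stdCovec i] := fun i => by
    simp only [← bivecBilin_apply]
    conv_rhs => rw [covec_eq_sum (fderiv ℝ H y)]
    simp
  have hρ' : fderiv ℝ ρ y (bivecSharp (P y) (fderiv ℝ H y))
      = ∑ i, fderiv ℝ ρ y (stdVec i) * P y ![fderiv ℝ H y, stdCovec i] := by
    simp [bivecSharp, map_sum, mul_comm]
  simp only [hcomp, Finset.sum_add_distrib, hanti, hexp, hρ', add_zero]
  linarith

/-- The Lie derivative of a density along a divergence-free vector field vanishes: the density is
infinitesimally preserved by the flow. -/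
theorem hasDerivAt_pullback_density {k : ℕ} (vol : Coord (k + 1) [⋀^Fin (k + 1)]→L[ℝ] ℝ)
    {ρ : Coord (k + 1) → ℝ} {Z : Coord (k + 1) → Coord (k + 1)}
    {F : ℝ × Coord (k + 1) → Coord (k + 1)} {s₀ : ℝ} {u₀ : Coord (k + 1)}
    (hρ : DifferentiableAt ℝ ρ (F (s₀, u₀))) (hZ : DifferentiableAt ℝ Z (F (s₀, u₀)))
    (hF : ContDiffAt ℝ 2 F (s₀, u₀))
    (hflow : ∀ᶠ p in nhds (s₀, u₀), fderiv ℝ F p (1, 0) = Z (F p))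
    (hdiv : fderiv ℝ ρ (F (s₀, u₀)) (Z (F (s₀, u₀)))
      + ρ (F (s₀, u₀)) * ∑ i, stdCovec i (fderiv ℝ Z (F (s₀, u₀)) (stdVec i)) = 0)
    (v : Fin (k + 1) → Coord (k + 1)) :
    HasDerivAt (fun s => ρ (F (s, u₀)) * vol (fun i => fderiv ℝ F (s, u₀) (0, v i))) 0 s₀ := by
  have hF1 : DifferentiableAt ℝ F (s₀, u₀) := hF.differentiableAt two_ne_zero
  have hF2 : DifferentiableAt ℝ (fderiv ℝ F) (s₀, u₀) :=
    (hF.fderiv_right (m := 1) (by norm_num)).differentiableAt one_ne_zero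
  set F2 := fderiv ℝ (fderiv ℝ F) (s₀, u₀) with hF2def
  have hsymm : ∀ p q, F2 p q = F2 q p := fun p q => (hF.isSymmSndFDerivAt (by simp)).eq p q
  have hpath : HasDerivAt (fun s : ℝ => (s, u₀)) ((1 : ℝ), (0 : Coord (k + 1))) s₀ :=
    (hasDerivAt_id s₀).prodMk (hasDerivAt_const s₀ u₀)
  have hd1 : HasDerivAt (fun s => F (s, u₀)) (Z (F (s₀, u₀))) s₀ := by
    have := hF1.hasFDerivAt.comp_hasDerivAt s₀ hpath
    rwa [hflow.self_of_nhds] at this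
  have hd2 : HasDerivAt (fun s => ρ (F (s, u₀)))
      (fderiv ℝ ρ (F (s₀, u₀)) (Z (F (s₀, u₀)))) s₀ :=
    hρ.hasFDerivAt.comp_hasDerivAt s₀ hd1
  -- The variational equation: the flow equation is differentiated in the space direction and mixed
  -- derivatives are exchanged.
  have hcross : ∀ w, F2 (1, 0) (0, w)
      = fderiv ℝ Z (F (s₀, u₀)) (fderiv ℝ F (s₀, u₀) (0, w)) := by
    intro w
    rw [hsymm]
    have e1 : HasFDerivAt (fun p => fderiv ℝ F p (1, 0))
        ((ContinuousLinearMap.apply ℝ (Coord (k + 1)) ((1 : ℝ), (0 : Coord (k + 1)))).comp F2)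
        (s₀, u₀) :=
      hasFDerivAt_clm_comp (ContinuousLinearMap.apply ℝ (Coord (k + 1)) ((1 : ℝ), _))
        hF2.hasFDerivAt
    have e2 : HasFDerivAt (fun p => Z (F p))
        ((fderiv ℝ Z (F (s₀, u₀))).comp (fderiv ℝ F (s₀, u₀))) (s₀, u₀) :=
      hZ.hasFDerivAt.comp (s₀, u₀) hF1.hasFDerivAt
    have e3 := (e1.congr_of_eventuallyEq (hflow.mono fun p hp => hp.symm)).unique e2
    exact congrArg (fun L => L (0, w)) e3
  have hd3 : ∀ i, HasDerivAt (fun s => fderiv ℝ F (s, u₀) (0, v i))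
      (fderiv ℝ Z (F (s₀, u₀)) (fderiv ℝ F (s₀, u₀) (0, v i))) s₀ := by
    intro i
    rw [← hcross]
    have e1 : HasDerivAt (fun s => fderiv ℝ F (s, u₀)) (F2 (1, 0)) s₀ :=
      hF2.hasFDerivAt.comp_hasDerivAt s₀ hpath
    simpa using e1.clm_apply (hasDerivAt_const s₀ ((0 : ℝ), v i))
  have hd4 : HasDerivAt (fun s => vol (fun i => fderiv ℝ F (s, u₀) (0, v i)))
      (∑ i, vol (Function.update (fun i => fderiv ℝ F (s₀, u₀) (0, v i)) i
        (fderiv ℝ Z (F (s₀, u₀)) (fderiv ℝ F (s₀, u₀) (0, v i))))) s₀ := by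
    have e1 := (vol.hasFDerivAt (fun i => fderiv ℝ F (s₀, u₀) (0, v i))).comp_hasDerivAt s₀
      (hasDerivAt_pi.2 hd3)
    refine HasDerivAt.congr_deriv e1 ?_
    simp [ContinuousMultilinearMap.linearDeriv_apply]
  have hd5 := hd2.mul hd4
  -- Varying each argument of `vol` by the linearised field adds up to the trace of `DZ`, the flat
  -- divergence of `Z`.
  rw [sum_update_eq_trace] at hd5
  refine HasDerivAt.congr_deriv hd5 ?_
  linear_combination (vol fun i => fderiv ℝ F (s₀, u₀) (0, v i)) * hdiv

theorem contDiffAt_smul_clm {E G H : Type*} [NormedAddCommGroup E] [NormedSpace ℝ E]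
    [NormedAddCommGroup G] [NormedSpace ℝ G] [NormedAddCommGroup H] [NormedSpace ℝ H]
    (S : G →L[ℝ] H) {c : E → ℝ} {f : E → G} {y : E} (hc : ContDiffAt ℝ ∞ c y)
    (hf : ContDiffAt ℝ ∞ f y) : ContDiffAt ℝ ∞ (fun z => c z • S (f z)) y :=
  hc.smul (S.contDiff.contDiffAt.comp y hf)

/-- In finite dimension the inverse of `P ↦ ι_P vol` is continuous, so smoothness of `ι_P vol`
passes to `P`. -/
theorem exists_clm_interiorBivec_leftInverse {k : ℕ} {vol : Coord (k + 2) [⋀^Fin (k + 2)]→L[ℝ] ℝ}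
    (hvol : vol ≠ 0) : ∃ S : (Coord (k + 2) [⋀^Fin k]→L[ℝ] ℝ) →L[ℝ] Bivec (k + 2),
      ∀ P, S (interiorBivec P vol) = P := by
  have : FiniteDimensional ℝ (Coord (k + 2) [⋀^Fin k]→L[ℝ] ℝ) :=
    Module.Finite.of_surjective (M := Bivec (k + 2)) (interiorBivecEquiv vol hvol).toLinearMap
      (interiorBivecEquiv vol hvol).surjective
  exact ⟨LinearMap.toContinuousLinearMap (E := Coord (k + 2) [⋀^Fin k]→L[ℝ] ℝ)
    (F' := Bivec (k + 2)) (interiorBivecEquiv vol hvol).symm.toLinearMap,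
    fun P => (interiorBivecEquiv vol hvol).symm_apply_apply P⟩

/-- A bivector field is smooth if its contraction with a smooth density is. -/
theorem contDiffAt_of_interiorBivec {k : ℕ} {vol : Coord (k + 2) [⋀^Fin (k + 2)]→L[ℝ] ℝ}
    (hvol : vol ≠ 0) {ρ : Coord (k + 2) → ℝ} {P : Coord (k + 2) → Bivec (k + 2)}
    {η : Coord (k + 2) → Coord (k + 2) [⋀^Fin k]→L[ℝ] ℝ} {y : Coord (k + 2)}
    (hρ : ContDiffAt ℝ ∞ ρ y) (hη : ContDiffAt ℝ ∞ η y) (hρ0 : ρ y ≠ 0)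
    (h : ∀ᶠ z in nhds y, interiorBivec (ρ z • P z) vol = η z) : ContDiffAt ℝ ∞ P y := by
  obtain ⟨S, hS⟩ := exists_clm_interiorBivec_leftInverse hvol
  have hsm : ContDiffAt ℝ ∞ (fun z => (ρ z)⁻¹ • S (η z)) y :=
    contDiffAt_smul_clm (H := Bivec (k + 2)) S (hρ.inv hρ0) hη
  refine ContDiffAt.congr_of_eventuallyEq hsm ?_
  filter_upwards [h, hρ.continuousAt.eventually_ne hρ0] with z hz hz0
  rw [← hz, hS, smul_smul, inv_mul_cancel₀ hz0, one_smul]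

/-! ### Passing to charts -/

section Charts

variable {m : ℕ} {M : Type*} [TopologicalSpace M] [ChartedSpace (EuclideanSpace ℝ (Fin m)) M]

/-- The value of a form at a point, as a form on the coordinate space. -/
def formAt {n : ℕ} (η : DiffForm m M n) (x : M) : Coord m [⋀^Fin n]→L[ℝ] ℝ := η x

/-- The value of a bivector field at a point, as a bivector on the coordinate space. -/
def bivecAt (π : BivectorField m M) (x : M) : Bivec m := π x

/-- The differential of a chart, as an endomorphism of the coordinate space. -/
def dChartAt (x₀ p : M) : Coord m →L[ℝ] Coord m := dChart x₀ p

/-- The differential of an inverse chart, as an endomorphism of the coordinate space. -/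
def dChartSymmAt (x₀ : M) (y : Coord m) : Coord m →L[ℝ] Coord m := dChartSymm x₀ y

theorem formInChart_eq {n : ℕ} (η : DiffForm m M n) (x₀ : M) (y : Coord m) :
    formInChart η x₀ y = (formAt η ((extChartAt (𝓡 m) x₀).symm y)).compContinuousLinearMap
      (dChartSymmAt x₀ y) := rfl

theorem compContinuousLinearMap_precomp_apply {n : ℕ} (P : Bivec n) (L : Coord n →L[ℝ] Coord n)
    (α β : Covec n) : P.compContinuousLinearMap (ContinuousLinearMap.precomp ℝ L) ![α, β]
      = P ![α.comp L, β.comp L] := by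
  rw [ContinuousAlternatingMap.compContinuousLinearMap_apply]
  congr 1
  ext a : 1
  fin_cases a <;> rfl

theorem bivectorInChart_eq (π : BivectorField m M) (x₀ : M) (y : Coord m) :
    bivectorInChart π x₀ y = (bivecAt π ((extChartAt (𝓡 m) x₀).symm y)).compContinuousLinearMap
      (ContinuousLinearMap.precomp ℝ (dChartAt x₀ ((extChartAt (𝓡 m) x₀).symm y))) := rfl

theorem bivectorInChart_apply (π : BivectorField m M) (x₀ : M) (y : Coord m) (α β : Covec m) :
    bivectorInChart π x₀ y ![α, β] = bivecAt π ((extChartAt (𝓡 m) x₀).symm y)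
      ![α.comp (dChartAt x₀ ((extChartAt (𝓡 m) x₀).symm y)),
        β.comp (dChartAt x₀ ((extChartAt (𝓡 m) x₀).symm y))] := by
  rw [bivectorInChart_eq, compContinuousLinearMap_precomp_apply]

theorem mvfderiv_eq_fderiv {h : M → ℝ} {x : M} (hh : MDifferentiableAt (𝓡 m) 𝓘(ℝ, ℝ) h x) :
    (mvfderiv (𝓡 m) h x : Covec m)
      = fderiv ℝ (h ∘ (extChartAt (𝓡 m) x).symm) (extChartAt (𝓡 m) x x) := by
  refine hh.mvfderiv.trans ?_
  rw [ModelWithCorners.range_eq_univ, fderivWithin_univ]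
  rfl

theorem SmoothFormOn.contDiffAt {n : ℕ} {η : DiffForm m M n} (hη : SmoothFormOn η univ) (x₀ : M)
    {y : Coord m} (hy : y ∈ (extChartAt (𝓡 m) x₀).target) :
    ContDiffAt ℝ ∞ (formInChart η x₀) y := by
  have := hη x₀
  rw [preimage_univ, inter_univ] at this
  exact this.contDiffAt ((isOpen_extChartAt_target x₀).mem_nhds hy)

variable [IsManifold (𝓡 m) ∞ M]

/-- The tangent space at `x` is identified with `ℝ^m` by the preferred chart at `x`. Hence local
representations taken at the centre of that chart are the tensors themselves. -/
theorem dChartAt_self (x : M) : dChartAt x x = ContinuousLinearMap.id ℝ (Coord m) :=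
  mfderiv_extChartAt_self (I := 𝓡 m) (x := x)

theorem dChartSymmAt_self (x : M) :
    dChartSymmAt x (extChartAt (𝓡 m) x x) = ContinuousLinearMap.id ℝ (Coord m) := by
  have := mfderivWithin_range_extChartAt_symm (I := 𝓡 m) (x := x)
  rw [ModelWithCorners.range_eq_univ, mfderivWithin_univ] at this
  exact this

theorem dChartSymmAt_comp_dChartAt (x₀ : M) {y : Coord m}
    (hy : y ∈ (extChartAt (𝓡 m) x₀).target) :
    (dChartSymmAt x₀ y).comp (dChartAt x₀ ((extChartAt (𝓡 m) x₀).symm y))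
      = ContinuousLinearMap.id ℝ (Coord m) := by
  have := mfderivWithin_extChartAt_symm_comp_mfderiv_extChartAt (I := 𝓡 m) hy
  rw [ModelWithCorners.range_eq_univ, mfderivWithin_univ] at this
  exact this

theorem formInChart_self {n : ℕ} (η : DiffForm m M n) (x : M) :
    formInChart η x (extChartAt (𝓡 m) x x) = formAt η x := by
  rw [formInChart_eq, dChartSymmAt_self, extChartAt_to_inv (I := 𝓡 m) x]
  rfl

theorem bivectorInChart_self (π : BivectorField m M) (x : M) :
    bivectorInChart π x (extChartAt (𝓡 m) x x) = bivecAt π x := by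
  refine bivec_ext fun α β => ?_
  rw [bivectorInChart_apply, extChartAt_to_inv (I := 𝓡 m) x, dChartAt_self]
  rfl

theorem formAt_extDer {n : ℕ} (η : DiffForm m M n) (x : M) :
    formAt (extDer η) x = extDeriv (formInChart η x) (extChartAt (𝓡 m) x x) := by
  have h1 : formAt (extDer η) x = (extDeriv (formInChart η x) (extChartAt (𝓡 m) x x)
      ).compContinuousLinearMap (dChartAt x x) := rfl
  rw [h1, dChartAt_self]
  rfl

theorem contDiffAt_comp_extChartAt_symm {h : M → ℝ} {V : Set M} (hV : IsOpen V)
    (hh : ContMDiffOn (𝓡 m) 𝓘(ℝ, ℝ) ∞ h V) (x₀ : M) {y : Coord m}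
    (hy : y ∈ (extChartAt (𝓡 m) x₀).target) (hyV : (extChartAt (𝓡 m) x₀).symm y ∈ V) :
    ContDiffAt ℝ ∞ (h ∘ (extChartAt (𝓡 m) x₀).symm) y := by
  have h1 : ContMDiffAt 𝓘(ℝ, Coord m) (𝓡 m) ∞ (extChartAt (𝓡 m) x₀).symm y :=
    (contMDiffOn_extChartAt_symm x₀).contMDiffAt ((isOpen_extChartAt_target x₀).mem_nhds hy)
  exact ((hh.contMDiffAt (hV.mem_nhds hyV)).comp y h1).contDiffAt

end Charts

/-! ### Densities, smoothness and divergence in charts -/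

section ChartsCodegreeTwo

variable {k : ℕ} {M : Type*} [TopologicalSpace M] [ChartedSpace (EuclideanSpace ℝ (Fin (k + 2))) M]

/-- The density of a top-degree form in the chart around `x₀`, relative to its value at `x₀`. -/
def chartDensity (Ω : DiffForm (k + 2) M (k + 2)) (x₀ : M) (y : Coord (k + 2)) : ℝ :=
  formInChart Ω x₀ y stdVec / formAt Ω x₀ stdVec

variable {Ω : DiffForm (k + 2) M (k + 2)}

theorem contDiffAt_chartDensity (hΩ : SmoothFormOn Ω univ) (x₀ : M)
    {y : Coord (k + 2)} (hy : y ∈ (extChartAt (𝓡 (k + 2)) x₀).target) :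
    ContDiffAt ℝ ∞ (chartDensity Ω x₀) y := by
  have h1 := (ContinuousAlternatingMap.apply ℝ (Coord (k + 2)) ℝ
    (stdVec : Fin (k + 2) → Coord (k + 2))).contDiff.contDiffAt.comp y
    (SmoothFormOn.contDiffAt hΩ x₀ hy)
  exact h1.div_const _

theorem formAt_stdVec_ne_zero (hΩ : ∀ x, Ω x ≠ 0) (x : M) : formAt Ω x stdVec ≠ 0 :=
  topForm_stdVec_ne_zero (Ω := formAt Ω x) (hΩ x)

theorem formInChart_eq_chartDensity_smul (hΩ : ∀ x, Ω x ≠ 0) (x₀ : M) (y : Coord (k + 2)) :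
    formInChart Ω x₀ y
      = chartDensity Ω x₀ y • formAt Ω x₀ := by
  refine topForm_ext ?_
  rw [ContinuousAlternatingMap.smul_apply, chartDensity, smul_eq_mul,
    div_mul_cancel₀ _ (formAt_stdVec_ne_zero hΩ x₀)]

variable [IsManifold (𝓡 (k + 2)) ∞ M]

/-- Naturality of `ι_P` under the differential of the inverse chart; pushing `π` forward and pulling
it back cancels on the chart target. -/
theorem interiorBivec_inChart (π : BivectorField (k + 2) M) (Ω : DiffForm (k + 2) M (k + 2))
    (x₀ : M) {y : Coord (k + 2)} (hy : y ∈ (extChartAt (𝓡 (k + 2)) x₀).target) :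
    interiorBivec (bivectorInChart π x₀ y) (formInChart Ω x₀ y)
      = formInChart (interiorBivector π Ω) x₀ y := by
  rw [formInChart_eq, formInChart_eq, ← interiorBivec_comp]
  have h : (bivectorInChart π x₀ y).compContinuousLinearMap
      (ContinuousLinearMap.precomp ℝ (dChartSymmAt x₀ y))
      = bivecAt π ((extChartAt (𝓡 (k + 2)) x₀).symm y) := by
    refine bivec_ext fun α β => ?_
    rw [compContinuousLinearMap_precomp_apply, bivectorInChart_apply,
      ContinuousLinearMap.comp_assoc, ContinuousLinearMap.comp_assoc,
      dChartSymmAt_comp_dChartAt x₀ hy]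
    rfl
  rw [h]
  rfl

theorem formInChart_ne_zero (hΩ : ∀ x, Ω x ≠ 0) (x₀ : M) {y : Coord (k + 2)}
    (hy : y ∈ (extChartAt (𝓡 (k + 2)) x₀).target) : formInChart Ω x₀ y ≠ 0 := by
  intro h0
  refine hΩ ((extChartAt (𝓡 (k + 2)) x₀).symm y) ?_
  change formAt Ω _ = 0
  ext v
  have h1 := congrArg (fun η => η.compContinuousLinearMap
    (dChartAt x₀ ((extChartAt (𝓡 (k + 2)) x₀).symm y)) v) h0
  rw [formInChart_eq] at h1
  refine Eq.trans (congrArg (formAt Ω _) ?_) h1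
  ext1 i
  exact (congrArg (fun L => L (v i)) (dChartSymmAt_comp_dChartAt x₀ hy)).symm

theorem chartDensity_ne_zero (hΩ : ∀ x, Ω x ≠ 0) (x₀ : M) {y : Coord (k + 2)}
    (hy : y ∈ (extChartAt (𝓡 (k + 2)) x₀).target) : chartDensity Ω x₀ y ≠ 0 :=
  div_ne_zero (topForm_stdVec_ne_zero (formInChart_ne_zero hΩ x₀ hy))
    (formAt_stdVec_ne_zero hΩ x₀)

variable {π : BivectorField (k + 2) M} {θ : DiffForm (k + 2) M k}

/-- The variable density of `Ω` is absorbed into the bivector, leaving the constant form `formAt Ω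
x₀`, as `extDeriv_interiorBivec` requires. -/
theorem interiorBivec_chartDensity_smul (hΩ : ∀ x, Ω x ≠ 0)
    (hπ : ∀ x, interiorBivector π Ω x = θ x) (x₀ : M) {y : Coord (k + 2)}
    (hy : y ∈ (extChartAt (𝓡 (k + 2)) x₀).target) :
    interiorBivec (chartDensity Ω x₀ y • bivectorInChart π x₀ y) (formAt Ω x₀) = formInChart θ x₀ y := by
  have h1 := interiorBivec_inChart π Ω x₀ hy
  rw [formInChart_eq_chartDensity_smul hΩ, interiorBivec_smul_right,
    ← interiorBivec_smul_left] at h1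
  rw [h1, show interiorBivector π Ω = θ from funext hπ]

theorem contDiffAt_bivectorInChart (hΩ : IsVolumeFormOn Ω univ) (hθ : SmoothFormOn θ univ)
    (hπ : ∀ x, interiorBivector π Ω x = θ x) (x₀ : M) {y : Coord (k + 2)}
    (hy : y ∈ (extChartAt (𝓡 (k + 2)) x₀).target) :
    ContDiffAt ℝ ∞ (bivectorInChart π x₀) y := by
  have hΩ0 : ∀ x, Ω x ≠ 0 := fun x => hΩ.2 x (mem_univ x)
  refine contDiffAt_of_interiorBivec (vol := formAt Ω x₀) (hΩ0 x₀)
    (contDiffAt_chartDensity hΩ.1 x₀ hy) (SmoothFormOn.contDiffAt hθ x₀ hy)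
    (chartDensity_ne_zero hΩ0 x₀ hy) ?_
  exact Filter.eventually_of_mem ((isOpen_extChartAt_target x₀).mem_nhds hy)
    fun z hz => interiorBivec_chartDensity_smul hΩ0 hπ x₀ hz

/-- If `ι_π Ω` is closed, then `π` is divergence-free. -/
theorem bivecDiv_inChart_eq_zero (hΩ : IsVolumeFormOn Ω univ) (hθ : SmoothFormOn θ univ)
    (hπ : ∀ x, interiorBivector π Ω x = θ x) (hclosed : ∀ x, extDer θ x = 0) (x : M) :
    bivecDiv (fun y => chartDensity Ω x y • bivectorInChart π x y)
      (extChartAt (𝓡 (k + 2)) x x) = 0 := by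
  have hΩ0 : ∀ x, Ω x ≠ 0 := fun x => hΩ.2 x (mem_univ x)
  have hx := mem_extChartAt_target (I := 𝓡 (k + 2)) x
  have hd : DifferentiableAt ℝ (fun y => chartDensity Ω x y • bivectorInChart π x y)
      (extChartAt (𝓡 (k + 2)) x x) :=
    (hasFDerivAt_fun_smul (G := Bivec (k + 2))
      ((contDiffAt_chartDensity hΩ.1 x hx).differentiableAt (by simp))
      ((contDiffAt_bivectorInChart hΩ hθ hπ x hx).differentiableAt (by simp))).differentiableAt
  have h1 := extDeriv_interiorBivec (formAt Ω x) hd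
  have h2 : (fun y => interiorBivec (chartDensity Ω x y • bivectorInChart π x y) (formAt Ω x))
      =ᶠ[nhds (extChartAt (𝓡 (k + 2)) x x)] formInChart θ x :=
    Filter.eventually_of_mem (extChartAt_target_mem_nhds x)
      fun y hy => interiorBivec_chartDensity_smul hΩ0 hπ x hy
  rw [h2.extDeriv_eq, ← formAt_extDer, show formAt (extDer θ) x = 0 from hclosed x] at h1
  -- The contraction of the divergence with `Ω x` is `dθ = 0`, and contraction with `Ω x` is
  -- injective.
  refine interiorVec_injective (hΩ0 x) (h1.symm.trans ?_)
  ext w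
  exact ((formAt Ω x).map_coord_zero (m := Matrix.vecCons 0 w) 0
    rfl).symm

end ChartsCodegreeTwo

/-! ### The Poisson structure -/

section Poisson

variable {k : ℕ} {M : Type*} [TopologicalSpace M] [ChartedSpace (EuclideanSpace ℝ (Fin (k + 2))) M]

/-- A tangent vector, as an element of the coordinate space. -/
def vecAt {x : M} (v : TangentSpace (𝓡 (k + 2)) x) : Coord (k + 2) := v

theorem exists_bivectorField {Ω : DiffForm (k + 2) M (k + 2)} (hΩ : ∀ x, Ω x ≠ 0)
    (θ : DiffForm (k + 2) M k) :
    ∃ π : BivectorField (k + 2) M, ∀ x, interiorBivector π Ω x = θ x := by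
  choose P hP using fun x => interiorBivec_surjective (Ω := formAt Ω x) (hΩ x) (formAt θ x)
  exact ⟨P, hP⟩

theorem bivectorField_unique {Ω : DiffForm (k + 2) M (k + 2)} (hΩ : ∀ x, Ω x ≠ 0)
    {π ψ : BivectorField (k + 2) M}
    (h : ∀ x, interiorBivector ψ Ω x = interiorBivector π Ω x) : ψ = π :=
  funext fun x => interiorBivec_injective (Ω := formAt Ω x) (hΩ x) (h x)

theorem rank_bivecAt_le {Ω : DiffForm (k + 2) M (k + 2)} (hΩ : ∀ x, Ω x ≠ 0)
    {π : BivectorField (k + 2) M} {ϱ : DiffForm (k + 2) M k} {a : M → ℝ} {x : M}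
    (hπ : interiorBivector π Ω x = a x • ϱ x) :
    (bivecMatrix (bivecAt π x)).rank ≤ formRank ϱ x :=
  rank_bivecMatrix_le (Ω := formAt Ω x) (η := formAt ϱ x) (hΩ x) hπ

theorem bivectorRank_le_rank_bivecAt (π : BivectorField (k + 2) M) (x : M) :
    bivectorRank π x ≤ (bivecMatrix (bivecAt π x)).rank :=
  finrank_range_le_rank_bivecMatrix (bivecAt π x) (sharp π x) fun _ => rfl

theorem smoothFormOn_smul {ϱ : DiffForm (k + 2) M k} (hϱ : SmoothFormOn ϱ univ)
    [IsManifold (𝓡 (k + 2)) ∞ M] {a : M → ℝ} (ha : ContMDiff (𝓡 (k + 2)) 𝓘(ℝ, ℝ) ∞ a) :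
    SmoothFormOn (fun y => a y • ϱ y) univ := by
  intro x₀ y hy
  have h1 := contDiffAt_comp_extChartAt_symm isOpen_univ ha.contMDiffOn x₀ hy.1 hy.2
  exact (h1.smul (SmoothFormOn.contDiffAt hϱ x₀ hy.1)).contDiffWithinAt

theorem contMDiffAt_one_div {a : M → ℝ} (ha : ContMDiff (𝓡 (k + 2)) 𝓘(ℝ, ℝ) ∞ a) {x : M}
    (hx : a x ≠ 0) : ContMDiffAt (𝓡 (k + 2)) 𝓘(ℝ, ℝ) ∞ (fun x => 1 / a x) x := by
  simpa only [one_div] using! ha.contMDiffAt.inv₀ hx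

variable [IsManifold (𝓡 (k + 2)) ∞ M] {Ω : DiffForm (k + 2) M (k + 2)}
  {π : BivectorField (k + 2) M} {θ : DiffForm (k + 2) M k}

theorem schoutenTerm_eq (x : M) (α β γ : Covec (k + 2)) :
    schoutenTerm π π x α β γ = fderiv ℝ (bivectorInChart π x) (extChartAt (𝓡 (k + 2)) x x)
      (bivecSharp (bivecAt π x) α) ![β, γ] := by
  have h1 : schoutenTerm π π x α β γ = fderiv ℝ (bivectorInChart π x)
      (extChartAt (𝓡 (k + 2)) x x) (dChartAt x x (bivecSharp (bivecAt π x) α)) ![β, γ] := rfl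
  rw [h1, dChartAt_self]
  rfl

/-- At the chart centre, `[π, π]` is twice the cyclic sum killed by the Plücker relations together
with `div(ρπ) = 0`. -/
theorem schouten_self_eq_zero (hΩ : IsVolumeFormOn Ω univ) (hθ : SmoothFormOn θ univ)
    (hπ : ∀ x, interiorBivector π Ω x = θ x) (hclosed : ∀ x, extDer θ x = 0)
    (hrank : ∀ x, (bivecMatrix (bivecAt π x)).rank ≤ 2) (x : M) (α β γ : Covec (k + 2)) :
    schouten π π x α β γ = 0 := by
  have hx := mem_extChartAt_target (I := 𝓡 (k + 2)) x
  have hΩ0 : ∀ x, Ω x ≠ 0 := fun x => hΩ.2 x (mem_univ x)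
  have h := sum_cyclic_eq_zero_of_bivecDiv_eq_zero
    ((contDiffAt_chartDensity hΩ.1 x hx).differentiableAt (by simp))
    ((contDiffAt_bivectorInChart hΩ hθ hπ x hx).differentiableAt (by simp))
    (chartDensity_ne_zero hΩ0 x hx) (bivecDiv_inChart_eq_zero hΩ hθ hπ hclosed x)
    (Filter.Eventually.of_forall fun z α β γ δ => by
      simp only [bivectorInChart_apply]
      exact bivec_pluecker (hrank _) _ _ _ _) α β γ
  rw [bivectorInChart_self] at h
  have h2 : schouten π π x α β γ
      = (schoutenTerm π π x α β γ + schoutenTerm π π x β γ α + schoutenTerm π π x γ α β)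
      + (schoutenTerm π π x α β γ + schoutenTerm π π x β γ α + schoutenTerm π π x γ α β) := rfl
  rw [h2, schoutenTerm_eq, schoutenTerm_eq, schoutenTerm_eq, h, add_zero]

theorem isPoissonOn_of_closed (hΩ : IsVolumeFormOn Ω univ) (hθ : SmoothFormOn θ univ)
    (hπ : ∀ x, interiorBivector π Ω x = θ x) (hclosed : ∀ x, extDer θ x = 0)
    (hrank : ∀ x, (bivecMatrix (bivecAt π x)).rank ≤ 2) (V : Set M) : IsPoissonOn π V :=
  ⟨fun x₀ _ hy => (contDiffAt_bivectorInChart hΩ hθ hπ x₀ hy.1).contDiffWithinAt,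
    fun x _ α β γ => schouten_self_eq_zero hΩ hθ hπ hclosed hrank x α β γ⟩

/-- The derivative of `1 / a` at a point. -/
theorem mvfderiv_one_div {a : M → ℝ} (ha : ContMDiff (𝓡 (k + 2)) 𝓘(ℝ, ℝ) ∞ a) {x : M}
    (hx : a x ≠ 0) :
    (mvfderiv (𝓡 (k + 2)) (fun x => 1 / a x) x : Covec (k + 2))
      = (-(a x ^ 2)⁻¹) • fderiv ℝ (a ∘ (extChartAt (𝓡 (k + 2)) x).symm)
        (extChartAt (𝓡 (k + 2)) x x) := by
  rw [mvfderiv_eq_fderiv ((contMDiffAt_one_div ha hx).mdifferentiableAt (by simp))]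
  have h1 : DifferentiableAt ℝ (a ∘ (extChartAt (𝓡 (k + 2)) x).symm)
      (extChartAt (𝓡 (k + 2)) x x) :=
    (contDiffAt_comp_extChartAt_symm isOpen_univ ha.contMDiffOn x (mem_extChartAt_target x)
      (mem_univ _)).differentiableAt (by simp)
  have hval : (a ∘ (extChartAt (𝓡 (k + 2)) x).symm) (extChartAt (𝓡 (k + 2)) x x) = a x := by
    simp
  have h2 := (hasDerivAt_inv (x := a x) hx).comp_hasFDerivAt_of_eq _ h1.hasFDerivAt hval.symm
  refine Eq.trans ?_ h2.fderiv
  congr 1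
  ext z
  simp

/-- The vector field `X` is Hamiltonian, with Hamiltonian function `1 / a`, where `a` does not
vanish. -/
theorem eq_hamVec_one_div (hΩ : ∀ x, Ω x ≠ 0) {ϱ : DiffForm (k + 2) M k}
    (hϱ : SmoothFormOn ϱ univ) {a : M → ℝ} (ha : ContMDiff (𝓡 (k + 2)) 𝓘(ℝ, ℝ) ∞ a)
    {X : (x : M) → TangentSpace (𝓡 (k + 2)) x} {x : M}
    (hX : interiorVec (X x) (Ω x) = extDer ϱ x)
    (haϱ : extDer (fun y => a y • ϱ y) x = 0)
    (hπ : interiorBivector π Ω x = a x • ϱ x) (hx : a x ≠ 0) :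
    X x = hamVec π (fun x => 1 / a x) x := by
  have hxt := mem_extChartAt_target (I := 𝓡 (k + 2)) x
  set y := extChartAt (𝓡 (k + 2)) x x with hy
  set f := a ∘ (extChartAt (𝓡 (k + 2)) x).symm with hf
  have hfy : f y = a x := by simp [hf, hy]
  have hdf : DifferentiableAt ℝ f y :=
    (contDiffAt_comp_extChartAt_symm isOpen_univ ha.contMDiffOn x hxt
      (mem_univ _)).differentiableAt (by simp)
  have hdϱ : DifferentiableAt ℝ (formInChart ϱ x) y :=
    (SmoothFormOn.contDiffAt hϱ x hxt).differentiableAt (by simp)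
  have h1 : formAt (extDer fun y => a y • ϱ y) x = extDeriv (fun z => f z • formInChart ϱ x z) y :=
    formAt_extDer _ x
  rw [extDeriv_fun_smul_form hdf hdϱ, formInChart_self, ← formAt_extDer, hfy,
    show formAt (extDer fun y => a y • ϱ y) x = 0 from haϱ,
    show formAt (extDer ϱ) x = interiorVec (vecAt (X x)) (formAt Ω x) from hX.symm] at h1
  have h2 : interiorBivec (bivecAt π x) (formAt Ω x) = a x • formAt ϱ x := hπ
  have h3 := covecWedge_interiorBivec (bivecAt π x) (fderiv ℝ f y) (formAt Ω x)
  rw [h2, covecWedge_smul] at h3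
  -- Multiplying `da ∧ ϱ + a ι_X Ω = 0` by `a` replaces `a da ∧ ϱ` by `ι_{π^♯ da} Ω`, whence `π^♯ da
  -- = -a² X`.
  have h4 : interiorVec (bivecSharp (bivecAt π x) (fderiv ℝ f y)) (formAt Ω x)
      = interiorVec ((-(a x ^ 2)) • (vecAt (X x))) (formAt Ω x) := by
    have h5 := congrArg (fun η => a x • η) h1
    simp only [smul_zero, smul_add, h3] at h5
    rw [interiorVec_smul_left, ← sub_eq_zero, h5]
    ext w
    simp
    ring
  have h6 := interiorVec_injective (Ω := formAt Ω x) (hΩ x) h4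
  have h7 : (hamVec π (fun x => 1 / a x) x : Coord (k + 2))
      = bivecSharp (bivecAt π x) (mvfderiv (𝓡 (k + 2)) (fun x => 1 / a x) x) := rfl
  have h8 : bivecSharp (bivecAt π x) ((-(a x ^ 2)⁻¹) • fderiv ℝ f y)
      = (-(a x ^ 2)⁻¹) • bivecSharp (bivecAt π x) (fderiv ℝ f y) := by
    refine coord_ext fun β => ?_
    rw [map_smul, apply_bivecSharp, apply_bivecSharp, ← bivecBilin_apply, map_smul]
    rfl
  have h9 : vecAt (X x) = bivecSharp (bivecAt π x) ((-(a x ^ 2)⁻¹) • fderiv ℝ f y) := by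
    rw [h8, h6, smul_smul, neg_mul_neg, inv_mul_cancel₀ (pow_ne_zero 2 hx), one_smul]
  refine h9.trans (Eq.trans ?_ h7.symm)
  exact congrArg (bivecSharp (bivecAt π x)) (mvfderiv_one_div ha hx).symm

end Poisson

/-! ### Invariance of volume forms under flows -/

theorem two_le_infty : (2 : WithTop ℕ∞) ≤ ∞ := WithTop.coe_le_coe.2 le_top

section Flow

variable {m : ℕ} {M : Type*} [TopologicalSpace M] [ChartedSpace (EuclideanSpace ℝ (Fin m)) M]

/-- The differential of a self-map, as an endomorphism of the coordinate space. -/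
def mfderivAt (f : M → M) (x : M) : Coord m →L[ℝ] Coord m := mfderiv (𝓡 m) (𝓡 m) f x

theorem formAt_pullbackForm {n : ℕ} (f : M → M) (η : DiffForm m M n) (x : M) :
    formAt (pullbackForm f η) x = (formAt η (f x)).compContinuousLinearMap (mfderivAt f x) := rfl

/-- The expression of a family of self-maps in the charts around `x` and `y₀`. -/
def flowInChart (Φ : ℝ × M → M) (x y₀ : M) (p : ℝ × Coord m) : Coord m :=
  extChartAt (𝓡 m) y₀ (Φ (p.1, (extChartAt (𝓡 m) x).symm p.2))

variable {D : Set (ℝ × M)} {Φ : ℝ × M → M}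

/-- Supplies a neighbourhood in time and space on which the flow is defined and stays in one target
chart, as differentiating the flow equation requires. -/
theorem eventually_mem_flow_domain (hD : IsOpen D)
    (hΦ : ContMDiffOn (𝓘(ℝ, ℝ).prod (𝓡 m)) (𝓡 m) ∞ Φ D) {x : M} {s₀ : ℝ} (hs₀ : (s₀, x) ∈ D) :
    ∀ᶠ p in nhds (s₀, extChartAt (𝓡 m) x x), p.2 ∈ (extChartAt (𝓡 m) x).target ∧
      (p.1, (extChartAt (𝓡 m) x).symm p.2) ∈ D ∧ Φ (p.1, (extChartAt (𝓡 m) x).symm p.2) ∈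
        (chartAt (EuclideanSpace ℝ (Fin m)) (Φ (s₀, x))).source := by
  have hc : ContinuousAt (fun p : ℝ × Coord m => (p.1, (extChartAt (𝓡 m) x).symm p.2))
      (s₀, extChartAt (𝓡 m) x x) :=
    continuousAt_fst.prodMk ((continuousAt_extChartAt_symm x).comp_of_eq continuousAt_snd rfl)
  have hx : (extChartAt (𝓡 m) x).symm (extChartAt (𝓡 m) x x) = x := extChartAt_to_inv x
  have h1 : ∀ᶠ p in nhds (s₀, extChartAt (𝓡 m) x x), p.2 ∈ (extChartAt (𝓡 m) x).target :=
    (continuous_snd.tendsto (s₀, extChartAt (𝓡 m) x x)).eventually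
      (extChartAt_target_mem_nhds (I := 𝓡 m) x)
  have hcv : Filter.Tendsto (fun p : ℝ × Coord m => (p.1, (extChartAt (𝓡 m) x).symm p.2))
      (nhds (s₀, extChartAt (𝓡 m) x x)) (nhds (s₀, x)) := by
    have := hc.tendsto
    simp only [hx] at this
    exact this
  have h2 := hcv.eventually (hD.mem_nhds hs₀)
  have hcΦ : ContinuousAt Φ (s₀, x) := (hΦ.contMDiffAt (hD.mem_nhds hs₀)).continuousAt
  have h3 := hcv.eventually (hcΦ.eventually ((chartAt (EuclideanSpace ℝ (Fin m))
    (Φ (s₀, x))).open_source.mem_nhds (mem_chart_source _ _)))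
  filter_upwards [h1, h2, h3] with p p1 p2 p3 using ⟨p1, p2, p3⟩

variable [IsManifold (𝓡 m) ∞ M]

theorem contDiffAt_flowInChart (hD : IsOpen D)
    (hΦ : ContMDiffOn (𝓘(ℝ, ℝ).prod (𝓡 m)) (𝓡 m) ∞ Φ D) (x y₀ : M) {p : ℝ × Coord m}
    (hp : p.2 ∈ (extChartAt (𝓡 m) x).target) (hpD : (p.1, (extChartAt (𝓡 m) x).symm p.2) ∈ D)
    (hpy : Φ (p.1, (extChartAt (𝓡 m) x).symm p.2) ∈ (chartAt (EuclideanSpace ℝ (Fin m)) y₀).source) :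
    ContDiffAt ℝ ∞ (flowInChart Φ x y₀) p := by
  have h1 : ContMDiffAt 𝓘(ℝ, Coord m) (𝓡 m) ∞ (extChartAt (𝓡 m) x).symm p.2 :=
    (contMDiffOn_extChartAt_symm x).contMDiffAt ((isOpen_extChartAt_target x).mem_nhds hp)
  have h2 : ContMDiffAt 𝓘(ℝ, ℝ × Coord m) 𝓘(ℝ, Coord m) ∞ (Prod.snd : ℝ × Coord m → Coord m) p :=
    contDiffAt_snd.contMDiffAt
  have h3 : ContMDiffAt 𝓘(ℝ, ℝ × Coord m) 𝓘(ℝ, ℝ) ∞ (Prod.fst : ℝ × Coord m → ℝ) p :=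
    contDiffAt_fst.contMDiffAt
  have h4 : ContMDiffAt 𝓘(ℝ, ℝ × Coord m) (𝓘(ℝ, ℝ).prod (𝓡 m)) ∞
      (fun p : ℝ × Coord m => (p.1, (extChartAt (𝓡 m) x).symm p.2)) p :=
    h3.prodMk (h1.comp p h2)
  have h5 := (hΦ.contMDiffAt (hD.mem_nhds hpD)).comp p h4
  have h6 : ContMDiffAt (𝓡 m) 𝓘(ℝ, Coord m) ∞ (extChartAt (𝓡 m) y₀)
      (Φ (p.1, (extChartAt (𝓡 m) x).symm p.2)) := contMDiffAt_extChartAt' hpy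
  exact (h6.comp p h5).contDiffAt

/-- The spatial derivative of a flow in charts. -/
theorem fderiv_flowInChart_space (hD : IsOpen D)
    (hΦ : ContMDiffOn (𝓘(ℝ, ℝ).prod (𝓡 m)) (𝓡 m) ∞ Φ D) {x y₀ : M} {s : ℝ} (hs : (s, x) ∈ D)
    (hy : Φ (s, x) ∈ (chartAt (EuclideanSpace ℝ (Fin m)) y₀).source) (v : Coord m) :
    fderiv ℝ (flowInChart Φ x y₀) (s, extChartAt (𝓡 m) x x) (0, v)
      = dChartAt y₀ (Φ (s, x)) (mfderivAt (fun q => Φ (s, q)) x v) := by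
  have hx : (extChartAt (𝓡 m) x).symm (extChartAt (𝓡 m) x x) = x := extChartAt_to_inv x
  have h1 : MDifferentiableAt (𝓡 m) (𝓡 m) (fun q => Φ (s, q)) x := by
    have h2 : ContMDiffAt (𝓡 m) (𝓘(ℝ, ℝ).prod (𝓡 m)) ∞ (fun q : M => (s, q)) x :=
      contMDiffAt_const.prodMk contMDiffAt_id
    exact ((hΦ.contMDiffAt (hD.mem_nhds hs)).comp x h2).mdifferentiableAt (by simp)
  have h3 : MDifferentiableAt (𝓡 m) 𝓘(ℝ, Coord m) (extChartAt (𝓡 m) y₀) (Φ (s, x)) :=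
    mdifferentiableAt_extChartAt hy
  have h4 := mfderiv_comp x h3 h1
  have h5 := (h3.comp x h1).mfderiv
  rw [ModelWithCorners.range_eq_univ, fderivWithin_univ] at h5
  have h6 : DifferentiableAt ℝ (flowInChart Φ x y₀) (s, extChartAt (𝓡 m) x x) :=
    (contDiffAt_flowInChart hD hΦ x y₀ (p := (s, extChartAt (𝓡 m) x x))
      (mem_extChartAt_target x) (by simpa only [hx] using hs)
      (by simpa only [hx] using hy)).differentiableAt (by simp)
  have h7 : HasFDerivAt (fun u : Coord m => (s, u)) (ContinuousLinearMap.inr ℝ ℝ (Coord m))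
      (extChartAt (𝓡 m) x x) := hasFDerivAt_prodMk_right s _
  have h8 : fderiv ℝ (fun u => flowInChart Φ x y₀ (s, u)) (extChartAt (𝓡 m) x x)
      = (fderiv ℝ (flowInChart Φ x y₀) (s, extChartAt (𝓡 m) x x)).comp
        (ContinuousLinearMap.inr ℝ ℝ (Coord m)) :=
    (h6.hasFDerivAt.comp (extChartAt (𝓡 m) x x) h7).fderiv
  have h9 := congrArg (fun L => L v) h8
  refine h9.symm.trans ?_
  exact congrArg (fun L : Coord m →L[ℝ] Coord m => L v) (h5.symm.trans h4)

/-- The time derivative of a flow in charts. -/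
theorem fderiv_flowInChart_time {Y : (x : M) → TangentSpace (𝓡 m) x} {V : Set M}
    (hflow : IsFlowOn Y V D Φ) (x y₀ : M) {p : ℝ × Coord m}
    (hp : p.2 ∈ (extChartAt (𝓡 m) x).target) (hpD : (p.1, (extChartAt (𝓡 m) x).symm p.2) ∈ D)
    (hpy : Φ (p.1, (extChartAt (𝓡 m) x).symm p.2) ∈ (chartAt (EuclideanSpace ℝ (Fin m)) y₀).source) :
    fderiv ℝ (flowInChart Φ x y₀) p (1, 0)
      = dChart y₀ (Φ (p.1, (extChartAt (𝓡 m) x).symm p.2))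
        (Y (Φ (p.1, (extChartAt (𝓡 m) x).symm p.2))) := by
  set q := (extChartAt (𝓡 m) x).symm p.2 with hq
  have hopen : IsOpen {t | (t, q) ∈ D} := hflow.isOpen.preimage (by fun_prop)
  have h1 := (hflow.integral q p.1 hpD).hasMFDerivAt (hopen.mem_nhds hpD)
  have h3 : MDifferentiableAt (𝓡 m) 𝓘(ℝ, Coord m) (extChartAt (𝓡 m) y₀) (Φ (p.1, q)) :=
    mdifferentiableAt_extChartAt hpy
  have h4 := (h3.hasMFDerivAt.comp p.1 h1).hasFDerivAt
  have h6 : DifferentiableAt ℝ (flowInChart Φ x y₀) p :=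
    (contDiffAt_flowInChart hflow.isOpen hflow.smooth x y₀ hp hpD hpy).differentiableAt (by simp)
  have h7 : HasFDerivAt (fun t : ℝ => (t, p.2)) (ContinuousLinearMap.inl ℝ ℝ (Coord m)) p.1 :=
    hasFDerivAt_prodMk_left p.1 _
  have h8 : HasFDerivAt (fun t => flowInChart Φ x y₀ (t, p.2))
      ((fderiv ℝ (flowInChart Φ x y₀) p).comp (ContinuousLinearMap.inl ℝ ℝ (Coord m))) p.1 :=
    HasFDerivAt.comp (g := flowInChart Φ x y₀) (f := fun t : ℝ => (t, p.2)) p.1 h6.hasFDerivAt h7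
  have h9 := congrArg (fun L : ℝ →L[ℝ] Coord m => L 1) (h8.unique h4)
  refine Eq.trans h9 ?_
  exact congrArg (dChartAt y₀ (Φ (p.1, q)))
    (one_smul ℝ (show Coord m from Y (Φ (p.1, q))))

end Flow

/-! ### Hamiltonian flows preserve the volume form -/

section Invariance

variable {k : ℕ} {M : Type*} [TopologicalSpace M] [ChartedSpace (EuclideanSpace ℝ (Fin (k + 2))) M]
  [IsManifold (𝓡 (k + 2)) ∞ M]

/-- The local representation of a Hamiltonian vector field. -/
theorem dChart_hamVec (π : BivectorField (k + 2) M) {h : M → ℝ} {V : Set M} (hV : IsOpen V)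
    (hh : ContMDiffOn (𝓡 (k + 2)) 𝓘(ℝ, ℝ) ∞ h V) (y₀ : M) {q : M} (hqV : q ∈ V)
    (hq : q ∈ (chartAt (EuclideanSpace ℝ (Fin (k + 2))) y₀).source) :
    dChart y₀ q (hamVec π h q) = bivecSharp (bivectorInChart π y₀ (extChartAt (𝓡 (k + 2)) y₀ q))
      (fderiv ℝ (h ∘ (extChartAt (𝓡 (k + 2)) y₀).symm) (extChartAt (𝓡 (k + 2)) y₀ q)) := by
  have hqs : q ∈ (extChartAt (𝓡 (k + 2)) y₀).source := by rwa [extChartAt_source]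
  have hinv : (extChartAt (𝓡 (k + 2)) y₀).symm (extChartAt (𝓡 (k + 2)) y₀ q) = q :=
    (extChartAt (𝓡 (k + 2)) y₀).left_inv hqs
  have hH : DifferentiableAt ℝ (h ∘ (extChartAt (𝓡 (k + 2)) y₀).symm)
      (extChartAt (𝓡 (k + 2)) y₀ q) :=
    (contDiffAt_comp_extChartAt_symm hV hh y₀ ((extChartAt (𝓡 (k + 2)) y₀).map_source hqs)
      (by rwa [hinv])).differentiableAt (by simp)
  have h3 : MDifferentiableAt (𝓡 (k + 2)) 𝓘(ℝ, Coord (k + 2)) (extChartAt (𝓡 (k + 2)) y₀) q :=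
    mdifferentiableAt_extChartAt hq
  have h4 := hH.hasFDerivAt.hasMFDerivAt.comp q h3.hasMFDerivAt
  have h5 : (h ∘ (extChartAt (𝓡 (k + 2)) y₀).symm) ∘ extChartAt (𝓡 (k + 2)) y₀ =ᶠ[nhds q] h := by
    filter_upwards [(isOpen_extChartAt_source (I := 𝓡 (k + 2)) y₀).mem_nhds hqs] with z hz
    simp only [Function.comp]
    rw [(extChartAt (𝓡 (k + 2)) y₀).left_inv hz]
  have h6 := (h4.congr_of_eventuallyEq h5.symm).mfderiv
  have h7 : (mvfderiv (𝓡 (k + 2)) h q : Covec (k + 2))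
      = (fderiv ℝ (h ∘ (extChartAt (𝓡 (k + 2)) y₀).symm) (extChartAt (𝓡 (k + 2)) y₀ q)).comp
        (dChartAt y₀ q) := h6
  have h8 : (dChart y₀ q (hamVec π h q) : Coord (k + 2))
      = dChartAt y₀ q (bivecSharp (bivecAt π q) (mvfderiv (𝓡 (k + 2)) h q)) := rfl
  rw [h8]
  refine coord_ext fun β => ?_
  rw [apply_bivecSharp, bivectorInChart_apply, hinv]
  refine (apply_bivecSharp (bivecAt π q) _ (β.comp (dChartAt y₀ q))).trans ?_
  exact congrArg (fun α => bivecAt π q ![α, β.comp (dChartAt y₀ q)]) h7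

variable {Ω : DiffForm (k + 2) M (k + 2)} {π : BivectorField (k + 2) M} {θ : DiffForm (k + 2) M k}

/-- The pull-back of a top-degree form by a flow, in charts. -/
theorem pullbackForm_eq_chartDensity_mul (hΩ : ∀ x, Ω x ≠ 0) {D : Set (ℝ × M)} {Φ : ℝ × M → M}
    (hD : IsOpen D) (hΦ : ContMDiffOn (𝓘(ℝ, ℝ).prod (𝓡 (k + 2))) (𝓡 (k + 2)) ∞ Φ D) {x y₀ : M}
    {s : ℝ} (hs : (s, x) ∈ D)
    (hy : Φ (s, x) ∈ (chartAt (EuclideanSpace ℝ (Fin (k + 2))) y₀).source)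
    (v : Fin (k + 2) → Coord (k + 2)) :
    formAt (pullbackForm (fun q => Φ (s, q)) Ω) x v
      = chartDensity Ω y₀ (flowInChart Φ x y₀ (s, extChartAt (𝓡 (k + 2)) x x))
        * formAt Ω y₀ (fun i => fderiv ℝ (flowInChart Φ x y₀) (s, extChartAt (𝓡 (k + 2)) x x)
          (0, v i)) := by
  have hys : Φ (s, x) ∈ (extChartAt (𝓡 (k + 2)) y₀).source := by rwa [extChartAt_source]
  have hinv := (extChartAt (𝓡 (k + 2)) y₀).left_inv hys
  have hF : flowInChart Φ x y₀ (s, extChartAt (𝓡 (k + 2)) x x)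
      = extChartAt (𝓡 (k + 2)) y₀ (Φ (s, x)) := by
    rw [flowInChart, extChartAt_to_inv (I := 𝓡 (k + 2)) x]
  have h1 := formInChart_eq_chartDensity_smul hΩ y₀ (extChartAt (𝓡 (k + 2)) y₀ (Φ (s, x)))
  have h2 := congrArg (fun η => η (fun i => fderiv ℝ (flowInChart Φ x y₀)
    (s, extChartAt (𝓡 (k + 2)) x x) (0, v i))) h1
  have h3 := dChartSymmAt_comp_dChartAt y₀ ((extChartAt (𝓡 (k + 2)) y₀).map_source hys)
  rw [hinv] at h3
  rw [hF]
  refine Eq.trans ?_ h2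
  rw [formAt_pullbackForm, formInChart_eq, hinv]
  refine congrArg (formAt Ω (Φ (s, x))) ?_
  ext1 i
  exact (congrArg (fun L => L (mfderivAt (fun q => Φ (s, q)) x (v i))) h3).symm.trans
    (congrArg (dChartSymmAt y₀ (extChartAt (𝓡 (k + 2)) y₀ (Φ (s, x)))) (fderiv_flowInChart_space hD hΦ hs hy (v i)).symm)

theorem flowInvariantOn_hamVec (hΩ : IsVolumeFormOn Ω univ) (hθ : SmoothFormOn θ univ)
    (hπ : ∀ x, interiorBivector π Ω x = θ x) (hclosed : ∀ x, extDer θ x = 0)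
    {V : Set M} (hV : IsOpen V) {h : M → ℝ} (hh : ContMDiffOn (𝓡 (k + 2)) 𝓘(ℝ, ℝ) ∞ h V) :
    FlowInvariantOn Ω (hamVec π h) V := by
  have hΩ0 : ∀ x, Ω x ≠ 0 := fun x => hΩ.2 x (mem_univ x)
  rintro D Φ hflow ⟨t, x⟩ hp
  have hseg : ∀ s ∈ uIcc 0 t, (s, x) ∈ D := hflow.segment _ hp
  have h0 : (0, x) ∈ D := hseg 0 left_mem_uIcc
  change formAt (pullbackForm (fun q => Φ (t, q)) Ω) x = formAt Ω x
  ext v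
  have hderiv : ∀ s₀, (s₀, x) ∈ D →
      HasDerivAt (fun s => formAt (pullbackForm (fun q => Φ (s, q)) Ω) x v) 0 s₀ := by
    intro s₀ hs₀
    -- The target chart is recentred at the current point for every `s₀`, since the divergence was
    -- computed only at chart centres.
    set y₀ := Φ (s₀, x) with hy₀
    have hy₀V : y₀ ∈ V := hflow.mapsTo hs₀
    have hF0 : flowInChart Φ x y₀ (s₀, extChartAt (𝓡 (k + 2)) x x)
        = extChartAt (𝓡 (k + 2)) y₀ y₀ := by
      rw [flowInChart, extChartAt_to_inv (I := 𝓡 (k + 2)) x]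
    have hy₀t := mem_extChartAt_target (I := 𝓡 (k + 2)) y₀
    have hH := contDiffAt_comp_extChartAt_symm hV hh y₀ hy₀t
      (by rwa [extChartAt_to_inv (I := 𝓡 (k + 2)) y₀])
    have hH2 : ContDiffAt ℝ 2 (h ∘ (extChartAt (𝓡 (k + 2)) y₀).symm)
        (extChartAt (𝓡 (k + 2)) y₀ y₀) := hH.of_le two_le_infty
    have hP := (contDiffAt_bivectorInChart hΩ hθ hπ y₀ hy₀t).differentiableAt (by simp)
    have hρ := (contDiffAt_chartDensity hΩ.1 y₀ hy₀t).differentiableAt (by simp)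
    have hdom := eventually_mem_flow_domain hflow.isOpen hflow.smooth hs₀
    have hF := hdom.self_of_nhds
    have key := hasDerivAt_pullback_density (formAt Ω y₀) (ρ := chartDensity Ω y₀)
      (Z := fun z => bivecSharp (bivectorInChart π y₀ z)
        (fderiv ℝ (h ∘ (extChartAt (𝓡 (k + 2)) y₀).symm) z))
      (F := flowInChart Φ x y₀) (s₀ := s₀) (u₀ := extChartAt (𝓡 (k + 2)) x x)
      (by rw [hF0]; exact hρ)
      (by
        rw [hF0]
        exact bivecSharp_fderiv_differentiableAt hP
          ((hH2.fderiv_right (m := 1) (by norm_num)).differentiableAt one_ne_zero))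
      ((contDiffAt_flowInChart hflow.isOpen hflow.smooth x y₀ hF.1 hF.2.1 hF.2.2).of_le two_le_infty)
      (by
        filter_upwards [hdom] with p hpd
        rw [fderiv_flowInChart_time hflow x y₀ hpd.1 hpd.2.1 hpd.2.2]
        exact dChart_hamVec π hV hh y₀ (hflow.mapsTo hpd.2.1) hpd.2.2)
      (by
        rw [hF0]
        exact divergence_hamiltonian hρ hP hH2
          (bivecDiv_inChart_eq_zero hΩ hθ hπ hclosed y₀))
      v
    refine key.congr_of_eventuallyEq ?_
    have hpath : Filter.Tendsto (fun s : ℝ => (s, extChartAt (𝓡 (k + 2)) x x)) (nhds s₀)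
        (nhds (s₀, extChartAt (𝓡 (k + 2)) x x)) :=
      (Continuous.prodMk continuous_id continuous_const).tendsto s₀
    filter_upwards [hpath.eventually hdom] with s hsd
    simp only [extChartAt_to_inv] at hsd
    exact pullbackForm_eq_chartDensity_mul hΩ0 hflow.isOpen hflow.smooth hsd.2.1 hsd.2.2 v
  -- The mean value inequality with bound zero on the segment from `0` to `t`, which the flow domain
  -- contains, reduces the claim to time `0`.
  have hconst := (convex_uIcc (0 : ℝ) t).norm_image_sub_le_of_norm_hasDerivWithin_le (C := 0)
    (fun s hs => (hderiv s (hseg s hs)).hasDerivWithinAt) (fun _ _ => by simp)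
    left_mem_uIcc right_mem_uIcc
  rw [zero_mul, norm_le_zero_iff, sub_eq_zero] at hconst
  rw [hconst]
  -- `Φ_0` is the identity only where it is defined; openness of `D` makes this a neighbourhood of
  -- `x`, enough for the differential.
  have hid : (fun q => Φ (0, q)) =ᶠ[nhds x] id := by
    have hc : Filter.Tendsto (fun q : M => ((0 : ℝ), q)) (nhds x) (nhds (0, x)) :=
      (Continuous.prodMk continuous_const continuous_id).tendsto x
    filter_upwards [hc.eventually (hflow.isOpen.mem_nhds h0)] with q hq
    exact hflow.initial _ hq
  have hmf : mfderivAt (fun q => Φ (0, q)) x = ContinuousLinearMap.id ℝ (Coord (k + 2)) :=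
    hid.mfderiv_eq.trans mfderiv_id
  rw [formAt_pullbackForm, hmf, hflow.initial _ h0]
  rfl

end Invariance

end Hamiltonization

end

/-! ### The main theorem -/

theorem theorem3p3 {k : ℕ} {M : Type*} [TopologicalSpace M]
    [ChartedSpace (EuclideanSpace ℝ (Fin (k + 2))) M] [IsManifold (𝓡 (k + 2)) ∞ M]
    (X : (x : M) → TangentSpace (𝓡 (k + 2)) x)
    (hX : ContMDiff (𝓡 (k + 2)) (𝓡 (k + 2)).tangent ∞
      (fun x => (X x : TangentBundle (𝓡 (k + 2)) M)))
    (Ω : Hamiltonization.DiffForm (k + 2) M (k + 2))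
    (hΩ : Hamiltonization.IsVolumeFormOn Ω Set.univ)
    (ϱ : Hamiltonization.DiffForm (k + 2) M k)
    (hϱ : Hamiltonization.SmoothFormOn ϱ Set.univ)
    (hrank : ∀ x, Hamiltonization.formRank ϱ x ≤ 2)
    (hXϱ : ∀ x, Hamiltonization.interiorVec (X x) (Ω x) = Hamiltonization.extDer ϱ x)
    (a : M → ℝ) (ha : ContMDiff (𝓡 (k + 2)) 𝓘(ℝ, ℝ) ∞ a)
    (haϱ : ∀ x, Hamiltonization.extDer (fun y => a y • ϱ y) x = 0) :
    ∃ π : Hamiltonization.BivectorField (k + 2) M,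
      -- `π` is the bivector field determined by `ι_π Ω = a ϱ`
      (∀ x, Hamiltonization.interiorBivector π Ω x = a x • ϱ x) ∧
      (∀ ψ : Hamiltonization.BivectorField (k + 2) M,
        (∀ x, Hamiltonization.interiorBivector ψ Ω x = a x • ϱ x) → ψ = π) ∧
      -- it is a unimodular Poisson structure of rank at most two, on `M` and on `{a ≠ 0}`
      Hamiltonization.IsUnimodularPoissonOn π Set.univ ∧
      Hamiltonization.IsUnimodularPoissonOn π {x | a x ≠ 0} ∧
      (∀ x, Hamiltonization.bivectorRank π x ≤ 2) ∧
      -- on `{a ≠ 0}`, the field `X` is Hamiltonian with Hamiltonian function `1 / a`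
      Hamiltonization.IsHamiltonianOn π X (fun x => 1 / a x) {x | a x ≠ 0} := by
  have hΩ0 : ∀ x, Ω x ≠ 0 := fun x => hΩ.2 x (Set.mem_univ x)
  have hθ := Hamiltonization.smoothFormOn_smul hϱ ha
  have hU : IsOpen {x | a x ≠ 0} := isOpen_ne_fun ha.continuous continuous_const
  obtain ⟨π, hπ⟩ := Hamiltonization.exists_bivectorField hΩ0 (fun x => a x • ϱ x)
  have hrankπ : ∀ x, (Hamiltonization.bivecMatrix (Hamiltonization.bivecAt π x)).rank ≤ 2 :=
    fun x => (Hamiltonization.rank_bivecAt_le hΩ0 (hπ x)).trans (hrank x)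
  have hpoisson := Hamiltonization.isPoissonOn_of_closed hΩ hθ hπ haϱ hrankπ
  refine ⟨π, hπ, fun ψ hψ => Hamiltonization.bivectorField_unique hΩ0 fun x =>
      (hψ x).trans (hπ x).symm,
    ⟨hpoisson _, Ω, hΩ, fun h hh =>
      Hamiltonization.flowInvariantOn_hamVec hΩ hθ hπ haϱ isOpen_univ hh⟩,
    ⟨hpoisson _, Ω, ⟨fun x₀ => (hΩ.1 x₀).mono fun y hy => ⟨hy.1, Set.mem_univ _⟩,
      fun x _ => hΩ0 x⟩, fun h hh =>
      Hamiltonization.flowInvariantOn_hamVec hΩ hθ hπ haϱ hU hh⟩,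
    fun x => (Hamiltonization.bivectorRank_le_rank_bivecAt π x).trans (hrankπ x),
    fun x hx => (Hamiltonization.contMDiffAt_one_div ha hx).contMDiffWithinAt,
    fun x hx => Hamiltonization.eq_hamVec_one_div hΩ0 hϱ ha (hXϱ x) (haϱ x) (hπ x) hx⟩
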